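/- Let $\mathcal H_A=\mathbb C^{a}$ and $\mathcal H_B=\mathbb C^{2^n}$, let $|\psi\rangle\in\mathcal H_A\otimes\mathcal H_B$ be a unit vector and $\rho=\mathrm{Tr}_A|\psi\rangle\langle\psi|\in\mathbb C^{2^n\times 2^n}$. We consider black-box quantum algorithms, which know $a$, $n$, $m$ and $\varepsilon$ but have access to $|\psi\rangle$ only through an oracle $O_\rho$: starting from a fixed state, they alternate oracle queries with arbitrary quantum channels on a finite-dimensional workspace, and finally perform a measurement and report a real number. All constants below are absolute (independent of $n,a,m,\varepsilon$ and of the oracle). 1. (Non-unitary copy-producing oracle.) Suppose $O_\rho:\sigma\mapsto\sigma\otimes|\psi\rangle\langle\psi|$. (a) There is $C>0$ such that for all $n\ge 0$, $a\ge 1$, $m\ge 0$ and $\varepsilon>0$ there is an algorithm making at most $C\,m/\varepsilon^2$ queries to $O_\rho$ which, for every unit vector $|\psi\rangle$, reports with probability greater than $2/3$ a number at distance at most $\varepsilon$ from $\mathrm{Tr}(\rho^m)$. (b) There are $c>0$ and $m_0$ such that for all $m\ge m_0$, $n\ge 1$ and $a\ge 2$, every algorithm which, for every unit vector $|\psi\rangle$,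 reports with probability at least $2/3$ a number at distance less than $1/3$ from $\mathrm{Tr}(\rho^m)$ makes at least $c\,m$ queries to $O_\rho$. 2. (Unitary purification oracle with known inverse.) Suppose $O_\rho$ is a unitary operator on $\mathcal H_A\otimes\mathcal H_B$ with $O_\rho|0\rangle=|\psi\rangle$, where $|0\rangle$ is a fixed basis vector; a query is one application of $O_\rho$ or of $O_\rho^{-1}$. (a) There is $C>0$ such that for all $n\ge 0$, $a\ge 1$, $m\ge 0$ and $\varepsilon>0$ there is an algorithm making at most $C\,m/\varepsilon$ queries which, for every unitary $O_\rho$, reports with probability greater than $2/3$ a number at distance at most $\varepsilon$ from $\mathrm{Tr}(\rho^m)$. (b) There are $c>0$ and $m_0$ such that for all $m\ge m_0$, $n\ge 1$ and $a\ge 2$, every algorithm which, for every unitary $O_\rho$, reports with probability at least $2/3$ a number at distance less than $1/3$ from $\mathrm{Tr}(\rho^m)$ makes at least $c\sqrt m$ queries, even if applications of $O_\rho$ and $O_\rho^{-1}$ controlled by a qubit are also allowed and counted as single queries. -/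

import Mathlib

open scoped Matrix Kronecker ComplexOrder

noncomputable section

namespace QuantumQuery

/-- Density matrices: positive semidefinite matrices of trace one. -/
structure IsDensity {ι : Type*} [Fintype ι] (σ : Matrix ι ι ℂ) : Prop where
  posSemidef : σ.PosSemidef
  trace_eq_one : σ.trace = 1

/-- A quantum channel (completely positive trace preserving map) from the system with basis `ι`
to the system with basis `κ`, given by a finite Kraus family `K₁, …, K_r` with `∑ Kᵢ† Kᵢ = 1`. -/
structure Channel (ι κ : Type*) [Fintype ι] [DecidableEq ι] [Fintype κ] where
  num : ℕ
  kraus : Fin num → Matrix κ ι ℂ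
  complete : ∑ i, (kraus i)ᴴ * kraus i = 1

/-- The action `σ ↦ ∑ Kᵢ σ Kᵢ†` of a channel on states. -/
def Channel.apply {ι κ : Type*} [Fintype ι] [DecidableEq ι] [Fintype κ]
    (Φ : Channel ι κ) (σ : Matrix ι ι ℂ) : Matrix κ κ ℂ :=
  ∑ i, Φ.kraus i * σ * (Φ.kraus i)ᴴ

/-- A measurement (POVM) with finitely many outcomes, together with the real number that is
reported at each outcome. -/
structure Measurement (ι : Type*) [Fintype ι] [DecidableEq ι] where
  num : ℕ
  effect : Fin num → Matrix ι ι ℂ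
  posSemidef : ∀ x, (effect x).PosSemidef
  complete : ∑ x, effect x = 1
  value : Fin num → ℝ

open Classical in
/-- The probability (Born rule) that measuring the state `σ` reports a number in the set `S`. -/
def Measurement.prob {ι : Type*} [Fintype ι] [DecidableEq ι]
    (M : Measurement ι) (σ : Matrix ι ι ℂ) (S : Set ℝ) : ℝ :=
  ∑ x with M.value x ∈ S, (M.effect x * σ).trace.re

/-- The rank one operator `|ψ⟩⟨ψ|`. -/
def ketBra {ι : Type*} (ψ : ι → ℂ) : Matrix ι ι ℂ :=
  Matrix.vecMulVec ψ (star ψ)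

/-- `ψ` is a unit vector: `⟨ψ|ψ⟩ = 1`. -/
def IsUnitVector {ι : Type*} [Fintype ι] (ψ : ι → ℂ) : Prop :=
  star ψ ⬝ᵥ ψ = 1

/-- The partial trace over the first tensor factor. -/
def partialTraceA {α β : Type*} [Fintype α] (M : Matrix (α × β) (α × β) ℂ) : Matrix β β ℂ :=
  Matrix.of fun b b' => ∑ x, M (x, b) (x, b')

/-- The state `ρ = Tr_A |ψ⟩⟨ψ|` of the second subsystem. -/
def reducedState {α β : Type*} [Fintype α] (ψ : α × β → ℂ) : Matrix β β ℂ :=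
  partialTraceA (ketBra ψ)

/-- The numbers within distance `ε` of `Tr (ρ ^ m)`. -/
def within {β : Type*} [Fintype β] [DecidableEq β] (ρ : Matrix β β ℂ) (m : ℕ) (ε : ℝ) : Set ℝ :=
  {v | ‖(v : ℂ) - (ρ ^ m).trace‖ ≤ ε}

/-- The numbers at distance less than `ε` from `Tr (ρ ^ m)`. -/
def strictlyWithin {β : Type*} [Fintype β] [DecidableEq β]
    (ρ : Matrix β β ℂ) (m : ℕ) (ε : ℝ) : Set ℝ :=
  {v | ‖(v : ℂ) - (ρ ^ m).trace‖ < ε}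

/-! ### The copy-producing (non-unitary) oracle -/

/-- The oracle `σ ↦ σ ⊗ |ψ⟩⟨ψ|`. -/
def copyOracle {ι κ : Type*} (ψ : κ → ℂ) (σ : Matrix ι ι ℂ) : Matrix (ι × κ) (ι × κ) ℂ :=
  σ ⊗ₖ ketBra ψ

/-- A black-box algorithm with access to a copy-producing oracle on `ℂ^a ⊗ ℂ^d`.
It has a workspace of some finite dimension, starts in a fixed state, and then repeats
"call the oracle, apply a channel that takes the workspace and the new copy back to the
workspace"; each entry of `steps` is one such round, hence one query. (Storing the copy,
discarding subsystems, intermediate measurements and classical control are channels.)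
At the end it measures the workspace and reports a real number. -/
structure CopyAlgorithm (a d : ℕ) where
  dim : ℕ
  start : Matrix (Fin dim) (Fin dim) ℂ
  start_isDensity : IsDensity start
  steps : List (Channel (Fin dim × (Fin a × Fin d)) (Fin dim))
  readout : Measurement (Fin dim)

namespace CopyAlgorithm

variable {a d : ℕ}

/-- The number of oracle queries. -/
def queries (alg : CopyAlgorithm a d) : ℕ := alg.steps.length

/-- The final state of the workspace when the oracle appends `|ψ⟩⟨ψ|`. -/
def finalState (alg : CopyAlgorithm a d) (ψ : Fin a × Fin d → ℂ) :
    Matrix (Fin alg.dim) (Fin alg.dim) ℂ :=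
  alg.steps.foldl (fun σ Φ => Φ.apply (copyOracle ψ σ)) alg.start

/-- The probability that the number reported by the algorithm lies in `S`. -/
def outputProb (alg : CopyAlgorithm a d) (ψ : Fin a × Fin d → ℂ) (S : Set ℝ) : ℝ :=
  alg.readout.prob (alg.finalState ψ) S

end CopyAlgorithm

/-! ### The unitary oracle with known inverse -/

/-- The state `|ψ⟩ = U |0⟩` prepared by the unitary oracle `U` on `ℂ^a ⊗ ℂ^d`, where `|0⟩` is the
basis vector `|0⟩ ⊗ |0⟩`. -/
def preparedState {a d : ℕ} [NeZero a] [NeZero d]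
    (U : Matrix (Fin a × Fin d) (Fin a × Fin d) ℂ) : Fin a × Fin d → ℂ :=
  U *ᵥ Pi.single (0, 0) 1

/-- A single call: to the oracle or to its inverse, plain or controlled by a qubit. -/
structure OracleCall where
  inverse : Bool
  controlled : Bool

/-- Basis of the algorithm's register: a control qubit, a workspace of dimension `w`, and the
target `ℂ^a ⊗ ℂ^d` of the oracle. -/
abbrev Register (w a d : ℕ) : Type := Fin 2 × Fin w × (Fin a × Fin d)

/-- The operator applied to the register by an oracle call: with `V = U` or `V = U†`, this is
`1 ⊗ 1 ⊗ V` for a plain call and `|0⟩⟨0| ⊗ 1 ⊗ 1 + |1⟩⟨1| ⊗ 1 ⊗ V` for a controlled one. -/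
def OracleCall.toMatrix {a d : ℕ} (c : OracleCall) (w : ℕ)
    (U : Matrix (Fin a × Fin d) (Fin a × Fin d) ℂ) :
    Matrix (Register w a d) (Register w a d) ℂ :=
  let V : Matrix (Fin a × Fin d) (Fin a × Fin d) ℂ := if c.inverse then Uᴴ else U
  let I : Matrix (Fin w) (Fin w) ℂ := 1
  if c.controlled then
    Matrix.diagonal ![1, 0] ⊗ₖ (I ⊗ₖ (1 : Matrix (Fin a × Fin d) (Fin a × Fin d) ℂ))
      + Matrix.diagonal ![0, 1] ⊗ₖ (I ⊗ₖ V)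
  else
    (1 : Matrix (Fin 2) (Fin 2) ℂ) ⊗ₖ (I ⊗ₖ V)

/-- A black-box algorithm with access to a unitary oracle on `ℂ^a ⊗ ℂ^d` and its inverse.
It starts in a fixed state of its register and then repeats "call the oracle, apply a channel";
each entry of `steps` is one such round, hence one query. At the end it measures the
register and reports a real number. -/
structure UnitaryAlgorithm (a d : ℕ) where
  dim : ℕ
  start : Matrix (Register dim a d) (Register dim a d) ℂ
  start_isDensity : IsDensity start
  steps : List (OracleCall × Channel (Register dim a d) (Register dim a d))
  readout : Measurement (Register dim a d)

namespace UnitaryAlgorithm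

variable {a d : ℕ}

/-- The number of oracle queries (to the oracle or its inverse, controlled or not). -/
def queries (alg : UnitaryAlgorithm a d) : ℕ := alg.steps.length

/-- The algorithm never uses controlled calls, only the oracle and its inverse themselves. -/
def UsesPlainCalls (alg : UnitaryAlgorithm a d) : Prop :=
  ∀ s ∈ alg.steps, s.1.controlled = false

/-- The final state of the register when the oracle is `U`. -/
def finalState (alg : UnitaryAlgorithm a d) (U : Matrix (Fin a × Fin d) (Fin a × Fin d) ℂ) :
    Matrix (Register alg.dim a d) (Register alg.dim a d) ℂ :=
  alg.steps.foldl
    (fun σ s => s.2.apply (s.1.toMatrix alg.dim U * σ * (s.1.toMatrix alg.dim U)ᴴ)) alg.start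

/-- The probability that the number reported by the algorithm lies in `S`. -/
def outputProb (alg : UnitaryAlgorithm a d) (U : Matrix (Fin a × Fin d) (Fin a × Fin d) ℂ)
    (S : Set ℝ) : ℝ :=
  alg.readout.prob (alg.finalState U) S

end UnitaryAlgorithm

end QuantumQuery

end

/-
The number `Tr (ρ ^ m)` is the expectation, in the state `|ψ⟩^{⊗m}`, of the operator that permutes
the `m` copies of the second subsystem cyclically.

For the first upper bound, the Hermitian part of this operator is averaged over `O(1/ε²)` disjoint
blocks of `m` copies; Chebyshev's inequality then bounds the failure probability of measuring the
average.

For the second upper bound, write `Ψ = |ψ⟩^{⊗m} ⊗ |+⟩`, let `G = 2|Ψ⟩⟨Ψ| - 1`, and let the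
involution `F` exchange the two values of the last qubit while applying the cyclic permutation or
its inverse. Then `⟨Ψ, F Ψ⟩ = Tr (ρ ^ m) = μ`, and applying `F` and `G` alternately to `Ψ` gives
vectors `u t` with `u (t + 2) + u t = 2 μ u (t + 1)`. Hence a superposition of the `u t` over a
clock register, with weights vanishing at both ends, is an approximate eigenvector with eigenvalue
`μ` of half the adjacency matrix of the path, and `O(1/ε)` clock values suffice for precision `ε`.
Each step costs at most `2 m` queries.

For the lower bounds, the reduced states of `|00⟩` and of `cos θ |00⟩ + sin θ |11⟩` with
`sin² θ ~ 1/m` have moments `Tr (ρ ^ m)` that differ by more than `2/3`. Purifications of the runs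
of an algorithm on the two inputs stay close: their overlap is multiplied by `⟨ψ, φ⟩ = cos θ` with
every copy, and their distance grows by at most `‖U - V‖` with every call of a unitary oracle.
Choosing reflections for `U` and `V` makes `‖U - V‖` of order `sin θ`.
-/

noncomputable section

namespace QuantumQuery

open Matrix

/-! ### Squared norms of vectors -/

/-- The squared Euclidean norm. Vectors are plain functions in this file, whose default norm in
Mathlib is the supremum norm. -/
def sqNorm {ι : Type*} [Fintype ι] (v : ι → ℂ) : ℝ := ∑ i, ‖v i‖ ^ 2

section sqNorm

variable {ι κ : Type*} [Fintype ι] [Fintype κ]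

lemma star_mul_self_eq_norm_sq (z : ℂ) : star z * z = ((‖z‖ ^ 2 : ℝ) : ℂ) := by
  rw [Complex.star_def, Complex.conj_mul', Complex.ofReal_pow]

lemma star_dotProduct_self (v : ι → ℂ) : star v ⬝ᵥ v = (sqNorm v : ℂ) := by
  simp only [dotProduct, sqNorm, Pi.star_apply, star_mul_self_eq_norm_sq, Complex.ofReal_sum]

lemma isUnitVector_iff {v : ι → ℂ} : IsUnitVector v ↔ sqNorm v = 1 := by
  rw [IsUnitVector, star_dotProduct_self, Complex.ofReal_eq_one]

lemma IsUnitVector.sqNorm_eq_one {v : ι → ℂ} (hv : IsUnitVector v) : sqNorm v = 1 :=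
  isUnitVector_iff.1 hv

lemma sqNorm_nonneg (v : ι → ℂ) : 0 ≤ sqNorm v := Finset.sum_nonneg fun _ _ => by positivity

lemma sqNorm_smul (c : ℂ) (v : ι → ℂ) : sqNorm (c • v) = ‖c‖ ^ 2 * sqNorm v := by
  simp only [sqNorm, Pi.smul_apply, smul_eq_mul, norm_mul, mul_pow, Finset.mul_sum]

lemma sqNorm_add_le (v w : ι → ℂ) : sqNorm (v + w) ≤ 2 * (sqNorm v + sqNorm w) := by
  simp only [sqNorm, ← Finset.sum_add_distrib, Finset.mul_sum]
  refine Finset.sum_le_sum fun i _ => ?_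
  calc ‖v i + w i‖ ^ 2 ≤ (‖v i‖ + ‖w i‖) ^ 2 := by gcongr; exact norm_add_le _ _
    _ ≤ 2 * (‖v i‖ ^ 2 + ‖w i‖ ^ 2) := add_sq_le

lemma sqNorm_comp_equiv (e : ι ≃ κ) (v : κ → ℂ) : sqNorm (v ∘ e) = sqNorm v :=
  e.sum_comp fun i => ‖v i‖ ^ 2

lemma IsUnitVector.comp_equiv {v : κ → ℂ} (hv : IsUnitVector v) (e : ι ≃ κ) :
    IsUnitVector (v ∘ e) := by
  rw [isUnitVector_iff, sqNorm_comp_equiv, hv.sqNorm_eq_one]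

lemma isUnitVector_single [DecidableEq ι] (i : ι) : IsUnitVector (Pi.single i (1 : ℂ)) := by
  rw [IsUnitVector, dotProduct_single_one, Pi.star_apply, Pi.single_eq_same, star_one]

lemma star_mulVec_dotProduct (A : Matrix ι κ ℂ) (v : κ → ℂ) (w : ι → ℂ) :
    star (A *ᵥ v) ⬝ᵥ w = star v ⬝ᵥ (Aᴴ *ᵥ w) := by
  rw [star_mulVec, dotProduct_mulVec]

lemma sqNorm_mulVec_of_conjTranspose_mul [DecidableEq κ] {A : Matrix ι κ ℂ} (hA : Aᴴ * A = 1)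
    (v : κ → ℂ) : sqNorm (A *ᵥ v) = sqNorm v := by
  rw [← Complex.ofReal_inj, ← star_dotProduct_self, star_mulVec_dotProduct, mulVec_mulVec, hA,
    one_mulVec, star_dotProduct_self]

lemma sqNorm_unitary_mulVec [DecidableEq ι] {A : Matrix ι ι ℂ} (hA : A ∈ unitaryGroup ι ℂ)
    (v : ι → ℂ) : sqNorm (A *ᵥ v) = sqNorm v :=
  sqNorm_mulVec_of_conjTranspose_mul (mem_unitaryGroup_iff'.1 hA) v

lemma IsUnitVector.unitary_mulVec [DecidableEq ι] {v : ι → ℂ} (hv : IsUnitVector v)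
    {A : Matrix ι ι ℂ} (hA : A ∈ unitaryGroup ι ℂ) : IsUnitVector (A *ᵥ v) := by
  rw [isUnitVector_iff, sqNorm_unitary_mulVec hA, hv.sqNorm_eq_one]

lemma sqNorm_mulVec_sub_smul {A : Matrix ι ι ℂ} (hA : A.IsHermitian) {v : ι → ℂ}
    (hv : IsUnitVector v) {μ : ℝ} (hμ : star v ⬝ᵥ (A *ᵥ v) = μ) :
    sqNorm (A *ᵥ v - (μ : ℂ) • v) = sqNorm (A *ᵥ v) - μ ^ 2 := by
  have hμ' : star (A *ᵥ v) ⬝ᵥ v = μ := by rw [star_mulVec_dotProduct, hA.eq, hμ]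
  rw [← Complex.ofReal_inj, ← star_dotProduct_self, star_sub, star_smul, sub_dotProduct,
    dotProduct_sub, dotProduct_sub, smul_dotProduct, smul_dotProduct, dotProduct_smul,
    dotProduct_smul, hμ', hμ, hv, star_dotProduct_self]
  simp only [Complex.star_def, Complex.conj_ofReal, smul_eq_mul, Complex.ofReal_sub,
    Complex.ofReal_pow]
  ring

lemma sqNorm_sum_of_orthogonal {I : Type*} [Fintype I] {v : I → ι → ℂ}
    (hv : Pairwise fun i j => star (v i) ⬝ᵥ v j = 0) :
    sqNorm (∑ i, v i) = ∑ i, sqNorm (v i) := by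
  classical
  rw [← Complex.ofReal_inj, ← star_dotProduct_self, star_sum, sum_dotProduct, Complex.ofReal_sum]
  refine Finset.sum_congr rfl fun i _ => ?_
  rw [dotProduct_sum, Finset.sum_eq_single_of_mem i (Finset.mem_univ i)
    fun j _ hji => hv hji.symm, star_dotProduct_self]

end sqNorm

/-! ### Rank one operators and reflections -/

section ketBra

variable {ι κ : Type*}

lemma conjTranspose_ketBra (v : ι → ℂ) : (ketBra v)ᴴ = ketBra v := by
  rw [ketBra, conjTranspose_vecMulVec, star_star]

variable [Fintype ι]

lemma mul_ketBra_mul (A : Matrix κ ι ℂ) (v : ι → ℂ) : A * ketBra v * Aᴴ = ketBra (A *ᵥ v) := by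
  rw [ketBra, ketBra, mul_vecMulVec, vecMulVec_mul, star_mulVec]

lemma trace_ketBra (v : ι → ℂ) : (ketBra v).trace = (sqNorm v : ℂ) := by
  rw [ketBra, trace_vecMulVec, dotProduct_comm, star_dotProduct_self]

lemma isDensity_ketBra {v : ι → ℂ} (hv : IsUnitVector v) : IsDensity (ketBra v) :=
  ⟨posSemidef_vecMulVec_self_star v, by
    rw [trace_ketBra, hv.sqNorm_eq_one, Complex.ofReal_one]⟩

lemma ketBra_mulVec (v w : ι → ℂ) : ketBra v *ᵥ w = (star v ⬝ᵥ w) • v := by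
  rw [ketBra, vecMulVec_mulVec, op_smul_eq_smul]

lemma ketBra_mul_ketBra (v w : ι → ℂ) :
    ketBra v * ketBra w = (star v ⬝ᵥ w) • vecMulVec v (star w) := by
  rw [ketBra, ketBra, vecMulVec_mul_vecMulVec, vecMulVec_smul]

lemma IsUnitVector.ketBra_mul_self {v : ι → ℂ} (hv : IsUnitVector v) :
    ketBra v * ketBra v = ketBra v := by
  rw [ketBra_mul_ketBra, hv, one_smul, ketBra]

lemma trace_ketBra_mul_ketBra (v w : ι → ℂ) :
    (ketBra v * ketBra w).trace = ((‖star v ⬝ᵥ w‖ ^ 2 : ℝ) : ℂ) := by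
  rw [ketBra_mul_ketBra, trace_smul, trace_vecMulVec, dotProduct_comm v, smul_eq_mul,
    ← star_mul_self_eq_norm_sq, mul_comm, ← star_dotProduct_star, star_star]

end ketBra

section reflection

variable {ι : Type*} [DecidableEq ι]

/-- The reflection `2|v⟩⟨v| - 1`, which for a unit vector `v` fixes `v` and negates the vectors
orthogonal to `v`. -/
def reflection (v : ι → ℂ) : Matrix ι ι ℂ := (2 : ℂ) • ketBra v - 1

lemma conjTranspose_reflection (v : ι → ℂ) : (reflection v)ᴴ = reflection v := by
  rw [reflection, conjTranspose_sub, conjTranspose_smul, conjTranspose_ketBra, conjTranspose_one,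
    star_ofNat]

variable [Fintype ι]

lemma reflection_mul_self {v : ι → ℂ} (hv : IsUnitVector v) :
    reflection v * reflection v = 1 := by
  simp only [reflection, sub_mul, mul_sub, smul_mul_assoc, mul_smul_comm, hv.ketBra_mul_self,
    one_mul, mul_one]
  module

lemma reflection_mem_unitaryGroup {v : ι → ℂ} (hv : IsUnitVector v) :
    reflection v ∈ unitaryGroup ι ℂ := by
  rw [mem_unitaryGroup_iff, star_eq_conjTranspose, conjTranspose_reflection,
    reflection_mul_self hv]

lemma reflection_mulVec (v w : ι → ℂ) :
    reflection v *ᵥ w = (2 * (star v ⬝ᵥ w)) • v - w := by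
  rw [reflection, sub_mulVec, one_mulVec, smul_mulVec, ketBra_mulVec, smul_smul]

lemma mul_reflection_mul {W : Matrix ι ι ℂ} (hW : W ∈ unitaryGroup ι ℂ) (v : ι → ℂ) :
    W * reflection v * Wᴴ = reflection (W *ᵥ v) := by
  have hWW : W * Wᴴ = 1 := mem_unitaryGroup_iff.1 hW
  rw [reflection, reflection, mul_sub, sub_mul, mul_one, hWW, mul_smul_comm, smul_mul_assoc,
    mul_ketBra_mul]

end reflection

/-! ### Measuring a Hermitian observable -/

section spectralMeasurement

variable {ι : Type*} [Fintype ι] [DecidableEq ι]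

lemma Measurement.prob_add_prob_compl (M : Measurement ι) (σ : Matrix ι ι ℂ) (S : Set ℝ) :
    M.prob σ S + M.prob σ Sᶜ = σ.trace.re := by
  classical
  have htrace : σ.trace.re = ∑ x, (M.effect x * σ).trace.re := by
    rw [← Complex.re_sum, ← trace_sum, ← Finset.sum_mul, M.complete, one_mul]
  rw [htrace, Measurement.prob, Measurement.prob,
    ← Finset.sum_filter_add_sum_filter_not Finset.univ fun x => M.value x ∈ S]
  congr!

variable {A : Matrix ι ι ℂ} (hA : A.IsHermitian)

/-- The projective measurement of a Hermitian observable in its eigenbasis, reporting the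
eigenvalue. -/
def spectralMeasurement : Measurement ι where
  num := Fintype.card ι
  effect x := ketBra fun i => (hA.eigenvectorUnitary : Matrix ι ι ℂ) i ((Fintype.equivFin ι).symm x)
  posSemidef _ := posSemidef_vecMulVec_self_star _
  complete := by
    rw [(Fintype.equivFin ι).symm.sum_comp
      fun y => ketBra fun i => (hA.eigenvectorUnitary : Matrix ι ι ℂ) i y,
      ← mem_unitaryGroup_iff.1 hA.eigenvectorUnitary.2]
    ext i j
    simp [ketBra, vecMulVec_apply, Matrix.sum_apply, mul_apply]
  value x := hA.eigenvalues ((Fintype.equivFin ι).symm x)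

open Classical in
lemma spectralMeasurement_prob_ketBra (v : ι → ℂ) (S : Set ℝ) :
    (spectralMeasurement hA).prob (ketBra v) S
      = ∑ i with hA.eigenvalues i ∈ S, ‖((hA.eigenvectorUnitary : Matrix ι ι ℂ)ᴴ *ᵥ v) i‖ ^ 2 := by
  rw [Measurement.prob, Finset.sum_filter, Finset.sum_filter, ← (Fintype.equivFin ι).symm.sum_comp]
  refine Finset.sum_congr rfl fun x _ => if_congr Iff.rfl ?_ rfl
  refine Eq.trans (congrArg Complex.re (trace_ketBra_mul_ketBra _ v)) ?_
  rw [Complex.ofReal_re]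
  rfl

lemma sqNorm_mulVec_sub_smul_eq_sum_eigenvalues (v : ι → ℂ) (μ : ℝ) :
    sqNorm (A *ᵥ v - (μ : ℂ) • v) = ∑ i, (hA.eigenvalues i - μ) ^ 2 *
      ‖((hA.eigenvectorUnitary : Matrix ι ι ℂ)ᴴ *ᵥ v) i‖ ^ 2 := by
  set V : Matrix ι ι ℂ := (hA.eigenvectorUnitary : Matrix ι ι ℂ)
  have hV : V ∈ unitaryGroup ι ℂ := hA.eigenvectorUnitary.2
  have hV' : Vᴴ ∈ unitaryGroup ι ℂ := Unitary.star_mem hV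
  have hdiag : Vᴴ * A = diagonal (fun i => (hA.eigenvalues i : ℂ)) * Vᴴ := by
    have hspec : A = V * diagonal (fun i => (hA.eigenvalues i : ℂ)) * Vᴴ := by
      refine hA.spectral_theorem.trans ?_
      rw [Unitary.conjStarAlgAut_apply]
      rfl
    have hVV : Vᴴ * V = 1 := mem_unitaryGroup_iff'.1 hV
    conv_lhs => rw [hspec, ← mul_assoc, ← mul_assoc, hVV, one_mul]
  rw [← sqNorm_unitary_mulVec hV', mulVec_sub, mulVec_smul, mulVec_mulVec, hdiag, ← mulVec_mulVec,
    sqNorm]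
  refine Finset.sum_congr rfl fun i _ => ?_
  rw [Pi.sub_apply, mulVec_diagonal, Pi.smul_apply, smul_eq_mul, ← sub_mul, norm_mul,
    mul_pow, ← Complex.ofReal_sub, Complex.norm_real, Real.norm_eq_abs, sq_abs]

/-- Chebyshev's inequality: `‖(A - μ) v‖²` is the second moment about `μ` of the reported value. -/
lemma one_sub_le_spectralMeasurement_prob_closedBall {v : ι → ℂ} (hv : IsUnitVector v) (μ : ℝ)
    {ε : ℝ} (hε : 0 < ε) :
    1 - sqNorm (A *ᵥ v - (μ : ℂ) • v) / ε ^ 2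
      ≤ (spectralMeasurement hA).prob (ketBra v) (Metric.closedBall μ ε) := by
  classical
  have hcompl : (spectralMeasurement hA).prob (ketBra v) (Metric.closedBall μ ε)ᶜ
      ≤ sqNorm (A *ᵥ v - (μ : ℂ) • v) / ε ^ 2 := by
    rw [spectralMeasurement_prob_ketBra, sqNorm_mulVec_sub_smul_eq_sum_eigenvalues hA,
      Finset.sum_filter, Finset.sum_div]
    refine Finset.sum_le_sum fun i _ => ?_
    split_ifs with hi
    · have hfar : ε ≤ |hA.eigenvalues i - μ| := by
        rw [← Real.dist_eq]
        exact (not_le.1 (Metric.mem_closedBall.not.1 hi)).le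
      rw [le_div_iff₀ (by positivity), mul_comm, ← sq_abs (hA.eigenvalues i - μ)]
      gcongr
    · positivity
  have htotal := (spectralMeasurement hA).prob_add_prob_compl (ketBra v) (Metric.closedBall μ ε)
  rw [trace_ketBra, hv.sqNorm_eq_one, Complex.ofReal_re] at htotal
  linarith

end spectralMeasurement

/-! ### Tensor products of families -/

section piVec

variable {ι κ : Type*} [Fintype ι]

/-- The tensor product of a finite family of vectors. -/
def piVec (v : ι → κ → ℂ) : (ι → κ) → ℂ := fun w => ∏ i, v i (w i)

variable [DecidableEq ι]

lemma piVec_update_apply (v : ι → κ → ℂ) (i : ι) (x : κ → ℂ) (w : ι → κ) :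
    piVec (Function.update v i x) w = x (w i) * ∏ j ∈ Finset.univ.erase i, v j (w j) := by
  rw [piVec, ← Finset.mul_prod_erase _ _ (Finset.mem_univ i), Function.update_self]
  congr 1
  exact Finset.prod_congr rfl fun j hj => by
    rw [Function.update_of_ne (Finset.ne_of_mem_erase hj)]

variable [Fintype κ]

lemma star_piVec_dotProduct_piVec (v w : ι → κ → ℂ) :
    star (piVec v) ⬝ᵥ piVec w = ∏ i, star (v i) ⬝ᵥ w i := by
  simp only [dotProduct, piVec, Pi.star_apply, star_prod, ← Finset.prod_mul_distrib]
  exact (Fintype.prod_sum fun i y => star (v i y) * w i y).symm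

lemma sqNorm_piVec (v : ι → κ → ℂ) : sqNorm (piVec v) = ∏ i, sqNorm (v i) := by
  rw [← Complex.ofReal_inj, ← star_dotProduct_self, star_piVec_dotProduct_piVec,
    Complex.ofReal_prod]
  exact Finset.prod_congr rfl fun i _ => star_dotProduct_self _

lemma IsUnitVector.piVec {v : ι → κ → ℂ} (hv : ∀ i, IsUnitVector (v i)) :
    IsUnitVector (piVec v) := by
  rw [IsUnitVector, star_piVec_dotProduct_piVec]
  exact Finset.prod_eq_one fun i _ => hv i

variable [DecidableEq κ]

/-- The tensor product of a finite family of square matrices, as a monoid homomorphism. -/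
def piTensor (ι κ : Type*) [Fintype ι] [DecidableEq ι] [Fintype κ] [DecidableEq κ] :
    (ι → Matrix κ κ ℂ) →* Matrix (ι → κ) (ι → κ) ℂ where
  toFun M := Matrix.of fun w w' => ∏ i, M i (w i) (w' i)
  map_one' := by
    ext w w'
    simp only [of_apply, Pi.one_apply, one_apply, Finset.prod_ite_zero, Finset.mem_univ,
      forall_true_left, Finset.prod_const_one, funext_iff]
  map_mul' M N := by
    ext w w'
    simp only [of_apply, Pi.mul_apply, mul_apply, ← Finset.prod_mul_distrib]
    exact Fintype.prod_sum fun i y => M i (w i) y * N i y (w' i)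

lemma piTensor_apply (M : ι → Matrix κ κ ℂ) (w w' : ι → κ) :
    piTensor ι κ M w w' = ∏ i, M i (w i) (w' i) := rfl

lemma conjTranspose_piTensor (M : ι → Matrix κ κ ℂ) :
    (piTensor ι κ M)ᴴ = piTensor ι κ fun i => (M i)ᴴ := by
  ext w w'
  simp only [conjTranspose_apply, piTensor_apply, star_prod]

lemma piTensor_mulVec_piVec (M : ι → Matrix κ κ ℂ) (v : ι → κ → ℂ) :
    piTensor ι κ M *ᵥ piVec v = piVec fun i => M i *ᵥ v i := by
  ext w
  simp only [mulVec, dotProduct, piVec, piTensor_apply, ← Finset.prod_mul_distrib]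
  exact (Fintype.prod_sum fun i y => M i (w i) y * v i y).symm

end piVec

/-! ### Moments of the reduced state as cyclic expectations -/

section cyclicSum

variable {β : Type*} [Fintype β] [DecidableEq β]

lemma sum_mul_prod_path (M : Matrix β β ℂ) (n : ℕ) (g : β → β → ℂ) :
    ∑ f : Fin (n + 1) → β, g (f 0) (f (Fin.last n)) * ∏ i : Fin n, M (f i.castSucc) (f i.succ)
      = ∑ x, ∑ y, g x y * (M ^ n) x y := by
  induction n generalizing g with
  | zero =>
    rw [← (Equiv.funUnique (Fin 1) β).symm.sum_comp]
    simp [one_apply]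
  | succ n ih =>
    rw [← (Fin.consEquiv fun _ => β).sum_comp, Fintype.sum_prod_type, Finset.sum_comm]
    simp only [Fin.consEquiv_apply, Fin.prod_univ_succ (n := n), Fin.castSucc_zero, Fin.cons_zero,
      Fin.cons_succ, ← Fin.succ_castSucc, ← Fin.succ_last]
    calc _ = ∑ f : Fin (n + 1) → β, (∑ x, g x (f (Fin.last n)) * M x (f 0)) *
          ∏ i : Fin n, M (f i.castSucc) (f i.succ) := by
          simp only [Finset.sum_mul, mul_assoc]
      _ = ∑ y, ∑ z, ∑ x, g x z * (M x y * (M ^ n) y z) := by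
          rw [ih fun y z => ∑ x, g x z * M x y]
          simp only [Finset.sum_mul, mul_assoc]
      _ = ∑ x, ∑ z, ∑ y, g x z * (M x y * (M ^ n) y z) := by
          rw [Finset.sum_comm, Finset.sum_congr rfl fun z _ => Finset.sum_comm, Finset.sum_comm]
      _ = _ := by
          simp only [pow_succ', mul_apply, Finset.mul_sum]

lemma sum_prod_finRotate_eq_trace_pow (M : Matrix β β ℂ) {m : ℕ} (hm : m ≠ 0) :
    ∑ f : Fin m → β, ∏ i, M (f i) (f (finRotate m i)) = (M ^ m).trace := by
  obtain ⟨n, rfl⟩ := Nat.exists_eq_succ_of_ne_zero hm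
  calc _ = ∑ f : Fin (n + 1) → β, M (f (Fin.last n)) (f 0) *
        ∏ i : Fin n, M (f i.castSucc) (f i.succ) := by
        refine Finset.sum_congr rfl fun f _ => ?_
        simp only [Fin.prod_univ_castSucc, mul_comm, finRotate_apply, Fin.coeSucc_eq_succ,
          Fin.last_add_one]
    _ = (M ^ (n + 1)).trace := by
        rw [sum_mul_prod_path M n fun x y => M y x, pow_succ, trace]
        simp only [diag_apply, mul_apply, mul_comm]

end cyclicSum

section powerTrace

variable {ι α β : Type*}

/-- The permutation of the basis of `⨂ᵢ (ℂ^α ⊗ ℂ^β)` that moves the second component of register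
`σ i` into register `i` and leaves all first components in place. -/
def permuteB (σ : Equiv.Perm ι) : Equiv.Perm (ι → α × β) where
  toFun w i := ((w i).1, (w (σ i)).2)
  invFun w i := ((w i).1, (w (σ.symm i)).2)
  left_inv w := by ext i <;> simp
  right_inv w := by ext i <;> simp

variable [Fintype α]

lemma reducedState_apply (ψ : α × β → ℂ) (b b' : β) :
    reducedState ψ b b' = ∑ x, ψ (x, b) * star (ψ (x, b')) := rfl

lemma conjTranspose_reducedState (ψ : α × β → ℂ) : (reducedState ψ)ᴴ = reducedState ψ := by
  ext b b'
  simp only [conjTranspose_apply, reducedState_apply, star_sum, star_mul', star_star, mul_comm]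

variable [Fintype β]

lemma star_piVec_dotProduct_comp_permuteB [Fintype ι] [DecidableEq ι] (ψ : α × β → ℂ)
    (σ : Equiv.Perm ι) :
    star (piVec fun _ : ι => ψ) ⬝ᵥ (piVec (fun _ : ι => ψ) ∘ permuteB σ)
      = ∑ f : ι → β, ∏ i, (reducedState ψ)ᵀ (f i) (f (σ i)) := by
  simp only [dotProduct, piVec, Pi.star_apply, star_prod, Function.comp_apply,
    ← Finset.prod_mul_distrib, permuteB, Equiv.coe_fn_mk, transpose_apply, reducedState_apply]
  rw [← (Equiv.arrowProdEquivProdArrow ι (fun _ => α) (fun _ => β)).symm.sum_comp,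
    Fintype.sum_prod_type, Finset.sum_comm]
  refine Finset.sum_congr rfl fun f _ => ?_
  rw [Fintype.prod_sum]
  refine Finset.sum_congr rfl fun g _ => Finset.prod_congr rfl fun i _ => ?_
  simp only [Equiv.arrowProdEquivProdArrow, Equiv.coe_fn_symm_mk, mul_comm]

variable [DecidableEq β]

/-- The real number `Tr (ρ ^ m)`. Taking the real part loses nothing for a reduced state `ρ`, see
`ofReal_powerTrace_reducedState`. -/
def powerTrace (ρ : Matrix β β ℂ) (m : ℕ) : ℝ := (ρ ^ m).trace.re

lemma ofReal_powerTrace_reducedState (ψ : α × β → ℂ) (m : ℕ) :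
    (powerTrace (reducedState ψ) m : ℂ) = (reducedState ψ ^ m).trace := by
  refine Complex.conj_eq_iff_re.1 ?_
  rw [← Complex.star_def, ← trace_conjTranspose, conjTranspose_pow, conjTranspose_reducedState]

lemma within_reducedState (ψ : α × β → ℂ) (m : ℕ) (ε : ℝ) :
    within (reducedState ψ) m ε = Metric.closedBall (powerTrace (reducedState ψ) m) ε := by
  ext x
  rw [within, Set.mem_ofPred_eq, ← ofReal_powerTrace_reducedState, ← Complex.ofReal_sub,
    Complex.norm_real, ← dist_eq_norm, Metric.mem_closedBall]

lemma strictlyWithin_reducedState (ψ : α × β → ℂ) (m : ℕ) (ε : ℝ) :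
    strictlyWithin (reducedState ψ) m ε = Metric.ball (powerTrace (reducedState ψ) m) ε := by
  ext x
  rw [strictlyWithin, Set.mem_ofPred_eq, ← ofReal_powerTrace_reducedState, ← Complex.ofReal_sub,
    Complex.norm_real, ← dist_eq_norm, Metric.mem_ball]

lemma star_piVec_dotProduct_comp_permuteB_finRotate (ψ : α × β → ℂ) {m : ℕ} (hm : m ≠ 0) :
    star (piVec fun _ : Fin m => ψ) ⬝ᵥ (piVec (fun _ : Fin m => ψ) ∘ permuteB (finRotate m))
      = powerTrace (reducedState ψ) m := by
  rw [star_piVec_dotProduct_comp_permuteB, sum_prod_finRotate_eq_trace_pow _ hm, ← transpose_pow,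
    trace_transpose, ofReal_powerTrace_reducedState]

lemma star_piVec_dotProduct_comp_permuteB_finRotate_symm (ψ : α × β → ℂ) {m : ℕ} (hm : m ≠ 0) :
    star (piVec fun _ : Fin m => ψ) ⬝ᵥ
        (piVec (fun _ : Fin m => ψ) ∘ (permuteB (finRotate m)).symm)
      = powerTrace (reducedState ψ) m := by
  rw [dotProduct_comp_equiv_symm, ← Complex.conj_ofReal,
    ← star_piVec_dotProduct_comp_permuteB_finRotate ψ hm, ← Complex.star_def, ← star_dotProduct]
  rfl

end powerTrace

/-! ### Traces of the states in a run -/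

section traces

lemma Channel.trace_apply {ι κ : Type*} [Fintype ι] [DecidableEq ι] [Fintype κ] (Φ : Channel ι κ)
    (σ : Matrix ι ι ℂ) : (Φ.apply σ).trace = σ.trace := by
  have hcyc : ∀ i, (Φ.kraus i * σ * (Φ.kraus i)ᴴ).trace
      = ((Φ.kraus i)ᴴ * Φ.kraus i * σ).trace := fun i => by
    rw [trace_mul_comm, ← Matrix.mul_assoc]
  rw [Channel.apply, trace_sum, Finset.sum_congr rfl fun i _ => hcyc i, ← trace_sum,
    ← Finset.sum_mul, Φ.complete, Matrix.one_mul]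

lemma trace_copyOracle {ι κ : Type*} [Fintype ι] [Fintype κ] {ψ : κ → ℂ} (hψ : IsUnitVector ψ)
    (σ : Matrix ι ι ℂ) : (copyOracle ψ σ).trace = σ.trace := by
  rw [copyOracle, trace_kronecker, trace_ketBra, hψ.sqNorm_eq_one, Complex.ofReal_one, mul_one]

lemma trace_mul_mul_conjTranspose {ι : Type*} [Fintype ι] [DecidableEq ι] {U : Matrix ι ι ℂ}
    (hU : U ∈ unitaryGroup ι ℂ) (σ : Matrix ι ι ℂ) : (U * σ * Uᴴ).trace = σ.trace := by
  rw [trace_mul_comm, ← mul_assoc, ← star_eq_conjTranspose, mem_unitaryGroup_iff'.1 hU, one_mul]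

lemma CopyAlgorithm.trace_finalState {a d : ℕ} (alg : CopyAlgorithm a d) {ψ : Fin a × Fin d → ℂ}
    (hψ : IsUnitVector ψ) : (alg.finalState ψ).trace = 1 :=
  List.foldlRecOn (motive := fun σ : Matrix _ _ ℂ => σ.trace = 1) alg.steps _
    alg.start_isDensity.trace_eq_one
    fun σ hσ Φ _ => by rw [Φ.trace_apply, trace_copyOracle hψ, hσ]

lemma controlled_mem_unitaryGroup {ι κ : Type*} [Fintype ι] [DecidableEq ι] [Fintype κ]
    [DecidableEq κ] {P : Matrix ι ι ℂ} (hP : P.IsHermitian) (hPP : P * P = P)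
    {A B : Matrix κ κ ℂ} (hA : A ∈ unitaryGroup κ ℂ) (hB : B ∈ unitaryGroup κ ℂ) :
    (1 - P) ⊗ₖ A + P ⊗ₖ B ∈ unitaryGroup (ι × κ) ℂ := by
  have hAA : Aᴴ * A = 1 := mem_unitaryGroup_iff'.1 hA
  have hBB : Bᴴ * B = 1 := mem_unitaryGroup_iff'.1 hB
  have hPQ : P * (1 - P) = 0 := by rw [mul_sub, mul_one, hPP, sub_self]
  have hQP : (1 - P) * P = 0 := by rw [sub_mul, one_mul, hPP, sub_self]
  have hQQ : (1 - P) * (1 - P) = 1 - P := by rw [sub_mul, one_mul, hPQ, sub_zero]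
  rw [mem_unitaryGroup_iff', star_eq_conjTranspose, conjTranspose_add, conjTranspose_kronecker,
    conjTranspose_kronecker, hP.eq, conjTranspose_sub, conjTranspose_one, hP.eq, add_mul, mul_add,
    mul_add]
  simp only [← mul_kronecker_mul, hAA, hBB, hPP, hPQ, hQP, hQQ, zero_kronecker, add_zero, zero_add]
  rw [← add_kronecker, sub_add_cancel, one_kronecker_one]

lemma OracleCall.toMatrix_mem_unitaryGroup {a d : ℕ} (c : OracleCall) (w : ℕ)
    {U : Matrix (Fin a × Fin d) (Fin a × Fin d) ℂ} (hU : U ∈ unitaryGroup (Fin a × Fin d) ℂ) :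
    c.toMatrix w U ∈ unitaryGroup (Register w a d) ℂ := by
  have hV : (if c.inverse then Uᴴ else U) ∈ unitaryGroup (Fin a × Fin d) ℂ := by
    split_ifs
    exacts [Unitary.star_mem hU, hU]
  have hIV := kronecker_mem_unitary (one_mem (unitaryGroup (Fin w) ℂ)) hV
  simp only [OracleCall.toMatrix]
  generalize (if c.inverse then Uᴴ else U) = V at hIV ⊢
  split_ifs
  · have hcontrol : diagonal ![1, 0] = 1 - diagonal (![0, 1] : Fin 2 → ℂ) := by
      rw [← diagonal_one, diagonal_sub]
      congr 1
      funext i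
      fin_cases i <;> simp
    rw [hcontrol, one_kronecker_one]
    refine controlled_mem_unitaryGroup ?_ ?_ (one_mem _) hIV
    · refine isHermitian_diagonal_of_self_adjoint _ ?_
      ext i
      fin_cases i <;> simp
    · rw [diagonal_mul_diagonal]
      congr 1
      funext i
      fin_cases i <;> simp
  · exact kronecker_mem_unitary (one_mem _) hIV

lemma UnitaryAlgorithm.trace_finalState {a d : ℕ} (alg : UnitaryAlgorithm a d)
    {U : Matrix (Fin a × Fin d) (Fin a × Fin d) ℂ} (hU : U ∈ unitaryGroup (Fin a × Fin d) ℂ) :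
    (alg.finalState U).trace = 1 :=
  List.foldlRecOn (motive := fun σ : Matrix _ _ ℂ => σ.trace = 1) alg.steps _
    alg.start_isDensity.trace_eq_one
    fun σ hσ s _ => by
      rw [s.2.trace_apply, trace_mul_mul_conjTranspose (s.1.toMatrix_mem_unitaryGroup _ hU), hσ]

end traces

/-! ### Purifications -/

section frobenius

open scoped Matrix.Norms.Frobenius

variable {ι κ l : Type*} [Fintype ι] [Fintype κ] [Fintype l]

lemma frobenius_norm_sq (X : Matrix κ l ℂ) : ‖X‖ ^ 2 = ∑ i, ∑ j, ‖X i j‖ ^ 2 := by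
  rw [frobenius_norm_def, ← Real.sqrt_eq_rpow, Real.sq_sqrt (by positivity)]
  simp only [Real.rpow_ofNat]

lemma frobenius_norm_sq_eq_trace (X : Matrix κ l ℂ) : ‖X‖ ^ 2 = (Xᴴ * X).trace.re := by
  rw [frobenius_norm_sq, Finset.sum_comm]
  simp only [trace, diag_apply, mul_apply, conjTranspose_apply, star_mul_self_eq_norm_sq,
    Complex.re_sum, Complex.ofReal_re]

lemma frobenius_norm_eq_one {X : Matrix κ l ℂ} (hX : (X * Xᴴ).trace = 1) : ‖X‖ = 1 := by
  rw [← sq_eq_sq₀ (norm_nonneg X) zero_le_one, frobenius_norm_sq_eq_trace, trace_mul_comm, hX,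
    Complex.one_re, one_pow]

lemma frobenius_norm_sub_sq (X Y : Matrix κ l ℂ) :
    ‖X - Y‖ ^ 2 = ‖X‖ ^ 2 + ‖Y‖ ^ 2 - 2 * (Xᴴ * Y).trace.re := by
  have hsymm : (Yᴴ * X).trace.re = (Xᴴ * Y).trace.re := by
    rw [← conjTranspose_conjTranspose X, ← conjTranspose_mul, trace_conjTranspose,
      conjTranspose_conjTranspose, Complex.star_def, Complex.conj_re]
  simp only [frobenius_norm_sq_eq_trace, conjTranspose_sub, Matrix.sub_mul, Matrix.mul_sub,
    trace_sub, Complex.sub_re, hsymm]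
  ring

lemma frobenius_norm_mul_of_conjTranspose_mul [DecidableEq ι] {U : Matrix κ ι ℂ}
    (hU : Uᴴ * U = 1) (Z : Matrix ι l ℂ) : ‖U * Z‖ = ‖Z‖ := by
  rw [← sq_eq_sq₀ (norm_nonneg _) (norm_nonneg _), frobenius_norm_sq_eq_trace,
    frobenius_norm_sq_eq_trace, conjTranspose_mul, Matrix.mul_assoc, ← Matrix.mul_assoc Uᴴ, hU,
    Matrix.one_mul]

lemma frobenius_norm_mul_le_of_posSemidef [DecidableEq ι] {B : Matrix κ ι ℂ}
    (hB : (1 - Bᴴ * B).PosSemidef) (Z : Matrix ι l ℂ) : ‖B * Z‖ ≤ ‖Z‖ := by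
  have hnonneg := (Complex.le_def.1 (hB.conjTranspose_mul_mul_same Z).trace_nonneg).1
  have hgap : (Zᴴ * (1 - Bᴴ * B) * Z).trace.re = ‖Z‖ ^ 2 - ‖B * Z‖ ^ 2 := by
    rw [frobenius_norm_sq_eq_trace, frobenius_norm_sq_eq_trace, conjTranspose_mul, Matrix.mul_sub,
      Matrix.sub_mul, trace_sub, Complex.sub_re, Matrix.mul_one]
    simp only [Matrix.mul_assoc]
  rw [hgap, Complex.zero_re, sub_nonneg] at hnonneg
  exact le_of_sq_le_sq hnonneg (norm_nonneg _)

lemma frobenius_norm_diagonal_kronecker_mul_le [DecidableEq ι] {r : ι → ℂ}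
    (hr : ∀ i, ‖r i‖ ≤ 1) {M : Matrix κ κ ℂ} {C : ℝ} (hC : 0 ≤ C)
    (hM : ∀ Y : Matrix κ l ℂ, ‖M * Y‖ ≤ C * ‖Y‖) (X : Matrix (ι × κ) l ℂ) :
    ‖(diagonal r ⊗ₖ M) * X‖ ≤ C * ‖X‖ := by
  have hblock (i : ι) (k : κ) (j : l) : ((diagonal r ⊗ₖ M) * X) (i, k) j
      = r i * (M * X.submatrix (Prod.mk i) id) k j := by
    simp only [mul_apply, Fintype.sum_prod_type, kroneckerMap_apply, diagonal_apply, ite_mul,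
      zero_mul, Finset.sum_ite_irrel, Finset.sum_const_zero, Finset.sum_ite_eq, Finset.mem_univ,
      if_true, Finset.mul_sum, mul_assoc, submatrix_apply, id_eq]
  have hsplit (Z : Matrix (ι × κ) l ℂ) :
      ‖Z‖ ^ 2 = ∑ i, ‖Z.submatrix (Prod.mk i) id‖ ^ 2 := by
    simp only [frobenius_norm_sq, Fintype.sum_prod_type, submatrix_apply, id_eq]
  refine le_of_sq_le_sq ?_ (by positivity)
  rw [mul_pow, hsplit, hsplit X, Finset.mul_sum]
  refine Finset.sum_le_sum fun i _ => ?_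
  have hrow : ((diagonal r ⊗ₖ M) * X).submatrix (Prod.mk i) id
      = r i • (M * X.submatrix (Prod.mk i) id) := Matrix.ext fun k j => hblock i k j
  rw [hrow, norm_smul, ← mul_pow]
  exact pow_le_pow_left₀ (by positivity)
    ((mul_le_of_le_one_left (norm_nonneg _) (hr i)).trans (hM _)) 2

end frobenius

section purification

open scoped Matrix.Norms.Frobenius

/-- The states `σ` and `τ` have purifications with inner product `z`. A purification of `σ` is
encoded as a matrix `X` with `X X† = σ`, the vector `∑ X i j |i⟩|j⟩` being the purifying one, so
that inner products of purifications become traces `Tr (X† Y)`. -/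
def PurifiedOverlap {ι : Type*} [Fintype ι] (σ τ : Matrix ι ι ℂ) (z : ℂ) : Prop :=
  ∃ (l : Type) (_ : Fintype l) (X Y : Matrix ι l ℂ),
    X * Xᴴ = σ ∧ Y * Yᴴ = τ ∧ (Xᴴ * Y).trace = z

/-- The states `σ` and `τ` have purifications, encoded as in `PurifiedOverlap`, at distance at
most `δ`. -/
def PurifiedWithin {ι : Type*} [Fintype ι] (σ τ : Matrix ι ι ℂ) (δ : ℝ) : Prop :=
  ∃ (l : Type) (_ : Fintype l) (X Y : Matrix ι l ℂ), X * Xᴴ = σ ∧ Y * Yᴴ = τ ∧ ‖X - Y‖ ≤ δ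

open scoped MatrixOrder in
lemma exists_eq_conjTranspose_mul_self {ι : Type*} [Fintype ι] {E : Matrix ι ι ℂ}
    (hE : E.PosSemidef) : ∃ B : Matrix ι ι ℂ, E = Bᴴ * B := by
  classical
  exact CStarAlgebra.nonneg_iff_eq_star_mul_self.1 hE.nonneg

lemma exists_eq_mul_conjTranspose_self {ι : Type*} [Fintype ι] {E : Matrix ι ι ℂ}
    (hE : E.PosSemidef) : ∃ B : Matrix ι ι ℂ, B * Bᴴ = E := by
  obtain ⟨B, rfl⟩ := exists_eq_conjTranspose_mul_self hE
  exact ⟨Bᴴ, by rw [conjTranspose_conjTranspose]⟩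

lemma IsDensity.purifiedOverlap_self {ι : Type} [Fintype ι] {σ : Matrix ι ι ℂ}
    (hσ : IsDensity σ) : PurifiedOverlap σ σ 1 := by
  obtain ⟨X, hX⟩ := exists_eq_mul_conjTranspose_self hσ.posSemidef
  exact ⟨ι, _, X, X, hX, hX, by rw [trace_mul_comm, hX, hσ.trace_eq_one]⟩

lemma IsDensity.purifiedWithin_self {ι : Type} [Fintype ι] {σ : Matrix ι ι ℂ}
    (hσ : IsDensity σ) : PurifiedWithin σ σ 0 := by
  obtain ⟨X, hX⟩ := exists_eq_mul_conjTranspose_self hσ.posSemidef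
  exact ⟨ι, _, X, X, hX, hX, by rw [sub_self, norm_zero]⟩

variable {ι κ : Type*} [Fintype ι] [Fintype κ]

section dilate

variable {l : Type*} [DecidableEq ι]

/-- The action of a channel on purifications: the Kraus index joins the purifying system. -/
def Channel.dilate (Φ : Channel ι κ) (Z : Matrix ι l ℂ) : Matrix κ (l × Fin Φ.num) ℂ :=
  Matrix.of fun i p => (Φ.kraus p.2 * Z) i p.1

lemma Channel.dilate_sub (Φ : Channel ι κ) (Y Z : Matrix ι l ℂ) :
    Φ.dilate (Y - Z) = Φ.dilate Y - Φ.dilate Z := by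
  ext i p
  simp only [dilate, of_apply, Matrix.mul_sub, Matrix.sub_apply]

variable [Fintype l]

lemma Channel.dilate_mul_conjTranspose (Φ : Channel ι κ) (Z : Matrix ι l ℂ) :
    Φ.dilate Z * (Φ.dilate Z)ᴴ = Φ.apply (Z * Zᴴ) := by
  have hkraus : Φ.apply (Z * Zᴴ) = ∑ i, (Φ.kraus i * Z) * (Φ.kraus i * Z)ᴴ := by
    simp only [Channel.apply, conjTranspose_mul, Matrix.mul_assoc]
  rw [hkraus]
  ext i j
  simp only [mul_apply, conjTranspose_apply, Matrix.sum_apply, Fintype.sum_prod_type_right]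
  simp only [dilate, of_apply, mul_apply]

lemma Channel.trace_conjTranspose_dilate_mul (Φ : Channel ι κ) (Y Z : Matrix ι l ℂ) :
    ((Φ.dilate Y)ᴴ * Φ.dilate Z).trace = (Yᴴ * Z).trace := by
  have hkraus : Yᴴ * Z = ∑ i, (Φ.kraus i * Y)ᴴ * (Φ.kraus i * Z) := by
    simp only [conjTranspose_mul, Matrix.mul_assoc]
    simp only [← Matrix.mul_sum, ← Matrix.mul_assoc _ _ Z, ← Matrix.sum_mul, Φ.complete]
    rw [Matrix.mul_one]
  rw [hkraus, trace_sum]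
  simp only [trace, diag_apply, mul_apply, conjTranspose_apply, Fintype.sum_prod_type_right]
  simp only [dilate, of_apply, mul_apply]

lemma Channel.norm_dilate (Φ : Channel ι κ) (Z : Matrix ι l ℂ) : ‖Φ.dilate Z‖ = ‖Z‖ := by
  rw [← sq_eq_sq₀ (norm_nonneg _) (norm_nonneg _), frobenius_norm_sq_eq_trace,
    frobenius_norm_sq_eq_trace, Φ.trace_conjTranspose_dilate_mul]

end dilate

lemma PurifiedOverlap.apply [DecidableEq ι] {σ τ : Matrix ι ι ℂ} {z : ℂ}
    (h : PurifiedOverlap σ τ z) (Φ : Channel ι κ) :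
    PurifiedOverlap (Φ.apply σ) (Φ.apply τ) z := by
  obtain ⟨l, _, X, Y, rfl, rfl, rfl⟩ := h
  exact ⟨_, inferInstance, Φ.dilate X, Φ.dilate Y, Φ.dilate_mul_conjTranspose X,
    Φ.dilate_mul_conjTranspose Y, Φ.trace_conjTranspose_dilate_mul X Y⟩

lemma PurifiedWithin.apply [DecidableEq ι] {σ τ : Matrix ι ι ℂ} {δ : ℝ}
    (h : PurifiedWithin σ τ δ) (Φ : Channel ι κ) :
    PurifiedWithin (Φ.apply σ) (Φ.apply τ) δ := by
  obtain ⟨l, _, X, Y, rfl, rfl, hδ⟩ := h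
  refine ⟨_, inferInstance, Φ.dilate X, Φ.dilate Y, Φ.dilate_mul_conjTranspose X,
    Φ.dilate_mul_conjTranspose Y, ?_⟩
  rwa [← Φ.dilate_sub, Φ.norm_dilate]

lemma PurifiedOverlap.copyOracle {σ τ : Matrix ι ι ℂ} {z : ℂ} (h : PurifiedOverlap σ τ z)
    (ψ φ : κ → ℂ) :
    PurifiedOverlap (copyOracle ψ σ) (copyOracle φ τ) (z * (star ψ ⬝ᵥ φ)) := by
  obtain ⟨l, _, X, Y, rfl, rfl, rfl⟩ := h
  have hcopy (Z : Matrix ι l ℂ) (v : κ → ℂ) :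
      (Z ⊗ₖ replicateCol Unit v) * (Z ⊗ₖ replicateCol Unit v)ᴴ
        = QuantumQuery.copyOracle v (Z * Zᴴ) := by
    rw [conjTranspose_kronecker, ← mul_kronecker_mul, QuantumQuery.copyOracle, ketBra,
      vecMulVec_eq Unit, conjTranspose_replicateCol]
  refine ⟨_, inferInstance, X ⊗ₖ replicateCol Unit ψ, Y ⊗ₖ replicateCol Unit φ, hcopy X ψ,
    hcopy Y φ, ?_⟩
  rw [conjTranspose_kronecker, ← mul_kronecker_mul, trace_kronecker, conjTranspose_replicateCol,
    trace_mul_comm (replicateRow _ _), ← vecMulVec_eq, trace_vecMulVec, dotProduct_comm]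

lemma PurifiedOverlap.purifiedWithin {σ τ : Matrix ι ι ℂ} {z : ℂ} (h : PurifiedOverlap σ τ z)
    (hσ : σ.trace = 1) (hτ : τ.trace = 1) : PurifiedWithin σ τ √(2 * (1 - z.re)) := by
  obtain ⟨l, _, X, Y, rfl, rfl, rfl⟩ := h
  refine ⟨l, _, X, Y, rfl, rfl, Real.le_sqrt_of_sq_le ?_⟩
  rw [frobenius_norm_sub_sq, frobenius_norm_eq_one hσ, frobenius_norm_eq_one hτ]
  linarith

lemma kronecker_sub_kronecker {ι ι' κ κ' : Type*} (A : Matrix ι ι' ℂ) (B C : Matrix κ κ' ℂ) :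
    A ⊗ₖ B - A ⊗ₖ C = A ⊗ₖ (B - C) := by
  ext i j
  simp only [Matrix.sub_apply, kroneckerMap_apply, mul_sub]

lemma OracleCall.norm_toMatrix_sub_mul_le {a d : ℕ} (c : OracleCall) (w : ℕ)
    (U V : Matrix (Fin a × Fin d) (Fin a × Fin d) ℂ) {l : Type*} [Fintype l]
    (X : Matrix (Register w a d) l ℂ) :
    ‖(c.toMatrix w U - c.toMatrix w V) * X‖ ≤ ‖U - V‖ * ‖X‖ := by
  have hdiff : ‖(if c.inverse then Uᴴ else U) - (if c.inverse then Vᴴ else V)‖ = ‖U - V‖ := by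
    split_ifs
    · rw [← conjTranspose_sub, frobenius_norm_conjTranspose]
    · rfl
  rw [← hdiff]
  simp only [OracleCall.toMatrix]
  generalize (if c.inverse then Uᴴ else U) = U'
  generalize (if c.inverse then Vᴴ else V) = V'
  have hworkspace (Y : Matrix (Fin w × Fin a × Fin d) l ℂ) :
      ‖((1 : Matrix (Fin w) (Fin w) ℂ) ⊗ₖ (U' - V')) * Y‖ ≤ ‖U' - V'‖ * ‖Y‖ := by
    rw [← diagonal_one]
    exact frobenius_norm_diagonal_kronecker_mul_le (fun _ => by rw [norm_one]) (norm_nonneg _)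
      (frobenius_norm_mul _) Y
  split_ifs
  · rw [add_sub_add_left_eq_sub, kronecker_sub_kronecker, kronecker_sub_kronecker]
    refine frobenius_norm_diagonal_kronecker_mul_le (fun i => ?_) (norm_nonneg _) hworkspace X
    fin_cases i <;> simp
  · rw [kronecker_sub_kronecker, kronecker_sub_kronecker, ← diagonal_one (n := Fin 2)]
    exact frobenius_norm_diagonal_kronecker_mul_le (fun _ => by rw [norm_one]) (norm_nonneg _)
      hworkspace X

lemma PurifiedWithin.oracleCall {a d w : ℕ} {σ τ : Matrix (Register w a d) (Register w a d) ℂ}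
    {δ : ℝ} (h : PurifiedWithin σ τ δ) (hτ : τ.trace = 1) (c : OracleCall)
    {U : Matrix (Fin a × Fin d) (Fin a × Fin d) ℂ} (hU : U ∈ unitaryGroup (Fin a × Fin d) ℂ)
    (V : Matrix (Fin a × Fin d) (Fin a × Fin d) ℂ) :
    PurifiedWithin (c.toMatrix w U * σ * (c.toMatrix w U)ᴴ)
      (c.toMatrix w V * τ * (c.toMatrix w V)ᴴ) (δ + ‖U - V‖) := by
  obtain ⟨l, _, X, Y, rfl, rfl, hδ⟩ := h
  have hconj (A : Matrix (Register w a d) (Register w a d) ℂ) (Z : Matrix (Register w a d) l ℂ) :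
      A * Z * (A * Z)ᴴ = A * (Z * Zᴴ) * Aᴴ := by
    rw [conjTranspose_mul]
    simp only [Matrix.mul_assoc]
  refine ⟨l, _, c.toMatrix w U * X, c.toMatrix w V * Y, hconj _ X, hconj _ Y, ?_⟩
  have hUU := mem_unitaryGroup_iff'.1 (c.toMatrix_mem_unitaryGroup w hU)
  calc ‖c.toMatrix w U * X - c.toMatrix w V * Y‖
      = ‖c.toMatrix w U * (X - Y) + (c.toMatrix w U - c.toMatrix w V) * Y‖ := by
        congr 1
        rw [Matrix.mul_sub, Matrix.sub_mul, sub_add_sub_cancel]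
    _ ≤ ‖X - Y‖ + ‖U - V‖ * ‖Y‖ := by
        grw [norm_add_le, frobenius_norm_mul_of_conjTranspose_mul hUU,
          c.norm_toMatrix_sub_mul_le]
    _ ≤ δ + ‖U - V‖ := by
        rw [frobenius_norm_eq_one hτ, mul_one]
        gcongr

end purification

/-! ### Distinguishing probabilities -/

section distinguish

open scoped Matrix.Norms.Frobenius

variable {ι : Type*} [Fintype ι] [DecidableEq ι]

lemma trace_mul_sub_trace_mul_le {E : Matrix ι ι ℂ} (hE : E.PosSemidef)
    (hE' : (1 - E).PosSemidef) {l : Type*} [Fintype l] {X Y : Matrix ι l ℂ} (hX : ‖X‖ = 1)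
    (hY : ‖Y‖ = 1) :
    (E * (X * Xᴴ)).trace.re - (E * (Y * Yᴴ)).trace.re ≤ 2 * ‖X - Y‖ := by
  obtain ⟨B, rfl⟩ := exists_eq_conjTranspose_mul_self hE
  have htrace (Z : Matrix ι l ℂ) : (Bᴴ * B * (Z * Zᴴ)).trace.re = ‖B * Z‖ ^ 2 := by
    rw [frobenius_norm_sq_eq_trace, conjTranspose_mul, ← Matrix.mul_assoc, trace_mul_comm]
    simp only [Matrix.mul_assoc]
  have hBX : ‖B * X‖ ≤ 1 := hX ▸ frobenius_norm_mul_le_of_posSemidef hE' X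
  have hBY : ‖B * Y‖ ≤ 1 := hY ▸ frobenius_norm_mul_le_of_posSemidef hE' Y
  have hdiff : ‖B * X‖ - ‖B * Y‖ ≤ ‖X - Y‖ := by
    refine (norm_sub_norm_le _ _).trans ?_
    rw [← Matrix.mul_sub]
    exact frobenius_norm_mul_le_of_posSemidef hE' _
  rw [htrace, htrace]
  nlinarith [norm_nonneg (B * X), norm_nonneg (B * Y), norm_nonneg (X - Y)]

open Classical in
/-- The effect of the event that the reported number lies in `S`. -/
def Measurement.event (M : Measurement ι) (S : Set ℝ) : Matrix ι ι ℂ :=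
  ∑ x with M.value x ∈ S, M.effect x

lemma Measurement.prob_eq_trace_event (M : Measurement ι) (σ : Matrix ι ι ℂ) (S : Set ℝ) :
    M.prob σ S = (M.event S * σ).trace.re := by
  simp only [Measurement.prob, Measurement.event, Finset.sum_mul, trace_sum, Complex.re_sum]

lemma Measurement.posSemidef_event (M : Measurement ι) (S : Set ℝ) : (M.event S).PosSemidef :=
  posSemidef_sum _ fun x _ => M.posSemidef x

lemma Measurement.one_sub_event (M : Measurement ι) (S : Set ℝ) :
    1 - M.event S = M.event Sᶜ := by
  classical
  rw [sub_eq_iff_eq_add, ← M.complete, Measurement.event, Measurement.event, add_comm,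
    ← Finset.sum_filter_add_sum_filter_not Finset.univ fun x => M.value x ∈ S]
  congr!

lemma Measurement.prob_mono (M : Measurement ι) {σ : Matrix ι ι ℂ} (hσ : σ.PosSemidef)
    {S T : Set ℝ} (hST : S ⊆ T) : M.prob σ S ≤ M.prob σ T := by
  classical
  obtain ⟨X, rfl⟩ := exists_eq_mul_conjTranspose_self hσ
  refine Finset.sum_le_sum_of_subset_of_nonneg
    (Finset.monotone_filter_right _ fun x _ hx => hST hx) fun x _ _ => ?_
  have hnonneg := ((M.posSemidef x).conjTranspose_mul_mul_same X).trace_nonneg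
  rw [Matrix.mul_assoc, trace_mul_comm, Matrix.mul_assoc] at hnonneg
  exact (Complex.le_def.1 hnonneg).1

lemma PurifiedWithin.prob_add_prob_le {σ τ : Matrix ι ι ℂ} {δ : ℝ} (h : PurifiedWithin σ τ δ)
    (hσ : σ.trace = 1) (hτ : τ.trace = 1) (M : Measurement ι) {S T : Set ℝ}
    (hST : Disjoint S T) : M.prob σ S + M.prob τ T ≤ 1 + 2 * δ := by
  obtain ⟨l, _, X, Y, rfl, rfl, hδ⟩ := h
  have hcompl : M.prob (Y * Yᴴ) S + M.prob (Y * Yᴴ) Sᶜ = 1 := by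
    rw [M.prob_add_prob_compl, hτ, Complex.one_re]
  have hT : M.prob (Y * Yᴴ) T ≤ M.prob (Y * Yᴴ) Sᶜ :=
    M.prob_mono (posSemidef_self_mul_conjTranspose Y) hST.subset_compl_left
  have hS : M.prob (X * Xᴴ) S - M.prob (Y * Yᴴ) S ≤ 2 * ‖X - Y‖ := by
    rw [M.prob_eq_trace_event, M.prob_eq_trace_event]
    exact trace_mul_sub_trace_mul_le (M.posSemidef_event S)
      (M.one_sub_event S ▸ M.posSemidef_event Sᶜ) (frobenius_norm_eq_one hσ)
      (frobenius_norm_eq_one hτ)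
  linarith

lemma CopyAlgorithm.purifiedOverlap_finalState {a d : ℕ} (alg : CopyAlgorithm a d)
    (ψ φ : Fin a × Fin d → ℂ) :
    PurifiedOverlap (alg.finalState ψ) (alg.finalState φ) ((star ψ ⬝ᵥ φ) ^ alg.queries) := by
  rw [finalState, finalState, queries]
  induction alg.steps using List.reverseRecOn with
  | nil => simpa using alg.start_isDensity.purifiedOverlap_self
  | append_singleton steps Φ ih =>
    rw [List.foldl_concat, List.foldl_concat, List.length_append, List.length_singleton, pow_succ]
    exact (ih.copyOracle ψ φ).apply Φ

theorem CopyAlgorithm.outputProb_add_outputProb_le {a d : ℕ} (alg : CopyAlgorithm a d)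
    {ψ φ : Fin a × Fin d → ℂ} (hψ : IsUnitVector ψ) (hφ : IsUnitVector φ) {S T : Set ℝ}
    (hST : Disjoint S T) :
    alg.outputProb ψ S + alg.outputProb φ T
      ≤ 1 + 2 * √(2 * (1 - ((star ψ ⬝ᵥ φ) ^ alg.queries).re)) :=
  ((alg.purifiedOverlap_finalState ψ φ).purifiedWithin (alg.trace_finalState hψ)
    (alg.trace_finalState hφ)).prob_add_prob_le (alg.trace_finalState hψ)
    (alg.trace_finalState hφ) alg.readout hST

lemma UnitaryAlgorithm.purifiedWithin_finalState {a d : ℕ} (alg : UnitaryAlgorithm a d)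
    {U V : Matrix (Fin a × Fin d) (Fin a × Fin d) ℂ} (hU : U ∈ unitaryGroup (Fin a × Fin d) ℂ)
    (hV : V ∈ unitaryGroup (Fin a × Fin d) ℂ) :
    PurifiedWithin (alg.finalState U) (alg.finalState V) (alg.queries * ‖U - V‖) := by
  rw [finalState, finalState, queries]
  induction alg.steps using List.reverseRecOn with
  | nil => simpa using alg.start_isDensity.purifiedWithin_self
  | append_singleton steps s ih =>
    rw [List.foldl_concat, List.foldl_concat, List.length_append, List.length_singleton,
      Nat.cast_add, Nat.cast_one, add_one_mul]
    exact (ih.oracleCall ({ alg with steps := steps }.trace_finalState hV) s.1 hU V).apply s.2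

theorem UnitaryAlgorithm.outputProb_add_outputProb_le {a d : ℕ} (alg : UnitaryAlgorithm a d)
    {U V : Matrix (Fin a × Fin d) (Fin a × Fin d) ℂ} (hU : U ∈ unitaryGroup (Fin a × Fin d) ℂ)
    (hV : V ∈ unitaryGroup (Fin a × Fin d) ℂ) {S T : Set ℝ} (hST : Disjoint S T) :
    alg.outputProb U S + alg.outputProb V T ≤ 1 + 2 * (alg.queries * ‖U - V‖) :=
  (alg.purifiedWithin_finalState hU hV).prob_add_prob_le (alg.trace_finalState hU)
    (alg.trace_finalState hV) alg.readout hST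

end distinguish

/-! ### Two inputs that are hard to tell apart -/

section planeVec

variable {κ : Type*} [DecidableEq κ]

/-- The unit vector `cos θ |p⟩ + sin θ |q⟩`. -/
def planeVec (p q : κ) (θ : ℝ) : κ → ℂ :=
  Pi.single p (Real.cos θ : ℂ) + Pi.single q (Real.sin θ : ℂ)

lemma planeVec_zero (p q : κ) : planeVec p q 0 = Pi.single p 1 := by
  rw [planeVec, Real.cos_zero, Real.sin_zero, Complex.ofReal_one, Complex.ofReal_zero,
    Pi.single_zero, add_zero]

variable [Fintype κ] {p q : κ}

lemma star_planeVec_dotProduct_planeVec (hpq : p ≠ q) (θ φ : ℝ) :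
    star (planeVec p q θ) ⬝ᵥ planeVec p q φ = (Real.cos (θ - φ) : ℂ) := by
  rw [Real.cos_sub]
  simp [planeVec, hpq, hpq.symm, -Complex.ofReal_cos, -Complex.ofReal_sin]

lemma isUnitVector_planeVec (hpq : p ≠ q) (θ : ℝ) : IsUnitVector (planeVec p q θ) := by
  rw [IsUnitVector, star_planeVec_dotProduct_planeVec hpq, sub_self, Real.cos_zero,
    Complex.ofReal_one]

lemma reflection_planeVec_mulVec_single (hpq : p ≠ q) (θ : ℝ) :
    reflection (planeVec p q θ) *ᵥ Pi.single p 1 = planeVec p q (2 * θ) := by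
  rw [reflection_mulVec, ← planeVec_zero p q, star_planeVec_dotProduct_planeVec hpq, sub_zero,
    planeVec_zero, planeVec, planeVec, Real.cos_two_mul, Real.sin_two_mul]
  ext i
  simp only [Pi.add_apply, Pi.sub_apply, Pi.smul_apply, Pi.single_apply, smul_eq_mul]
  push_cast
  split_ifs <;> ring

open scoped Matrix.Norms.Frobenius in
lemma norm_reflection_planeVec_sub_reflection_sq (hpq : p ≠ q) (θ φ : ℝ) :
    ‖reflection (planeVec p q θ) - reflection (planeVec p q φ)‖ ^ 2
      = 8 * Real.sin (θ - φ) ^ 2 := by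
  have hnorm (θ : ℝ) : ‖ketBra (planeVec p q θ)‖ = 1 := by
    have hv := isUnitVector_planeVec hpq θ
    refine frobenius_norm_eq_one ?_
    rw [conjTranspose_ketBra, hv.ketBra_mul_self, trace_ketBra, hv.sqNorm_eq_one,
      Complex.ofReal_one]
  rw [reflection, reflection, sub_sub_sub_cancel_right, ← smul_sub, norm_smul, mul_pow,
    frobenius_norm_sub_sq, hnorm, hnorm, conjTranspose_ketBra, trace_ketBra_mul_ketBra,
    star_planeVec_dotProduct_planeVec hpq, Complex.norm_real, Real.norm_eq_abs, sq_abs,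
    Complex.ofReal_re, Real.cos_sq', Complex.norm_ofNat]
  ring

variable {α β : Type*} [Fintype α] [DecidableEq α] [DecidableEq β] {x₀ x₁ : α}

lemma reducedState_planeVec (hx : x₀ ≠ x₁) (y₀ y₁ : β) (θ : ℝ) :
    reducedState (planeVec (x₀, y₀) (x₁, y₁) θ)
      = diagonal (Pi.single y₀ (Real.cos θ ^ 2 : ℂ) + Pi.single y₁ (Real.sin θ ^ 2 : ℂ)) := by
  ext b b'
  rw [reducedState_apply, diagonal_apply,
    Fintype.sum_eq_add x₀ x₁ hx fun z hz => by simp [planeVec, hz.1, hz.2]]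
  simp only [planeVec, Pi.add_apply, Pi.single_apply, Prod.mk.injEq, true_and, hx, hx.symm,
    false_and, if_false]
  by_cases h : b = b' <;> by_cases h₀ : b = y₀ <;> by_cases h₁ : b = y₁ <;>
    by_cases h₀' : b' = y₀ <;> by_cases h₁' : b' = y₁ <;>
    simp_all [sq, -Complex.ofReal_cos, -Complex.ofReal_sin]

lemma powerTrace_planeVec [Fintype β] (hx : x₀ ≠ x₁) {y₀ y₁ : β} (hy : y₀ ≠ y₁) (θ : ℝ) {m : ℕ}
    (hm : m ≠ 0) :
    powerTrace (reducedState (planeVec (x₀, y₀) (x₁, y₁) θ)) m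
      = (Real.cos θ ^ 2) ^ m + (Real.sin θ ^ 2) ^ m := by
  have hpow : (Pi.single y₀ (Real.cos θ ^ 2 : ℂ) + Pi.single y₁ (Real.sin θ ^ 2 : ℂ) : β → ℂ) ^ m
      = Pi.single y₀ (((Real.cos θ ^ 2) ^ m : ℝ) : ℂ)
        + Pi.single y₁ (((Real.sin θ ^ 2) ^ m : ℝ) : ℂ) := by
    ext b
    by_cases h₀ : b = y₀ <;> by_cases h₁ : b = y₁ <;> simp_all
  rw [powerTrace, reducedState_planeVec hx, diagonal_pow, hpow, trace_diagonal]
  simp only [Pi.add_apply, Finset.sum_add_distrib, Finset.sum_pi_single', Finset.mem_univ, if_true,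
    Complex.add_re, Complex.ofReal_re]

end planeVec

section hardAngle

/-- The angle `θ ∈ [0, π / 2]` with `sin² θ = 1 / m`; the hard inputs are
`cos 2θ |00⟩ + sin 2θ |11⟩` and `|00⟩`. -/
def hardAngle (m : ℕ) : ℝ := Real.arcsin √(1 / m)

lemma sin_hardAngle_sq (m : ℕ) : Real.sin (hardAngle m) ^ 2 = 1 / m := by
  have hle : √(1 / m : ℝ) ≤ 1 := by
    rw [Real.sqrt_le_one, one_div]
    exact Nat.cast_inv_le_one m
  rw [hardAngle, Real.sin_arcsin (by linarith [Real.sqrt_nonneg (1 / m : ℝ)]) hle,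
    Real.sq_sqrt (by positivity)]

lemma cos_two_mul_hardAngle (m : ℕ) : Real.cos (2 * hardAngle m) = 1 - 2 / m := by
  rw [Real.cos_two_mul, Real.cos_sq', sin_hardAngle_sq]
  ring

variable {m : ℕ}

lemma cos_two_mul_hardAngle_sq_pow_le (hm : 20 ≤ m) :
    (Real.cos (2 * hardAngle m) ^ 2) ^ m ≤ 1 / 10 := by
  have hm' : (20 : ℝ) ≤ m := by exact_mod_cast hm
  have hinv : 1 / (m : ℝ) ≤ 1 / 20 := by gcongr
  have hcos : Real.cos (2 * hardAngle m) ^ 2 ≤ 1 - 3 / m := by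
    rw [cos_two_mul_hardAngle, ← mul_one_div, ← mul_one_div 3]
    nlinarith [show 0 < 1 / (m : ℝ) by positivity]
  calc (Real.cos (2 * hardAngle m) ^ 2) ^ m ≤ (1 - 3 / m) ^ m := by gcongr
    _ ≤ Real.exp (-3) := Real.one_sub_div_pow_le_exp_neg (by linarith)
    _ = (Real.exp 1 ^ 3)⁻¹ := by rw [Real.exp_neg, Real.exp_one_pow, Nat.cast_ofNat]
    _ ≤ ((2.7 : ℝ) ^ 3)⁻¹ := by gcongr; linarith [Real.exp_one_gt_d9]
    _ ≤ 1 / 10 := by norm_num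

lemma sin_two_mul_hardAngle_sq_pow_le (hm : 20 ≤ m) :
    (Real.sin (2 * hardAngle m) ^ 2) ^ m ≤ 1 / 5 := by
  have hm' : (20 : ℝ) ≤ m := by exact_mod_cast hm
  have hinv : 1 / (m : ℝ) ≤ 1 / 20 := by gcongr
  have hsin : Real.sin (2 * hardAngle m) ^ 2 ≤ 1 / 5 := by
    rw [Real.sin_sq, cos_two_mul_hardAngle, ← mul_one_div]
    nlinarith [show 0 < 1 / (m : ℝ) by positivity]
  exact (pow_le_of_le_one (by positivity) (hsin.trans (by norm_num)) (by lia)).trans hsin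

lemma disjoint_strictlyWithin_planeVec {α β : Type*} [Fintype α] [DecidableEq α] [Fintype β]
    [DecidableEq β] {x₀ x₁ : α} (hx : x₀ ≠ x₁) {y₀ y₁ : β} (hy : y₀ ≠ y₁) (hm : 20 ≤ m) :
    Disjoint
      (strictlyWithin (reducedState (planeVec (x₀, y₀) (x₁, y₁) (2 * hardAngle m))) m (1 / 3))
      (strictlyWithin (reducedState (planeVec (x₀, y₀) (x₁, y₁) 0)) m (1 / 3)) := by
  have hm0 : m ≠ 0 := by lia
  rw [strictlyWithin_reducedState, strictlyWithin_reducedState, powerTrace_planeVec hx hy _ hm0,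
    powerTrace_planeVec hx hy _ hm0]
  refine Metric.ball_disjoint_ball ?_
  rw [Real.cos_zero, Real.sin_zero, zero_pow two_ne_zero, zero_pow hm0, one_pow, one_pow, add_zero,
    dist_comm, Real.dist_eq]
  refine le_trans ?_ (le_abs_self _)
  linarith [cos_two_mul_hardAngle_sq_pow_le hm, sin_two_mul_hardAngle_sq_pow_le hm]

end hardAngle

/-! ### Lower bounds -/

lemma CopyAlgorithm.le_queries {a d m : ℕ} (ha : 2 ≤ a) (hd : 2 ≤ d) (hm : 20 ≤ m)
    (alg : CopyAlgorithm a d)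
    (h : ∀ ψ : Fin a × Fin d → ℂ, IsUnitVector ψ →
      2 / 3 ≤ alg.outputProb ψ (strictlyWithin (reducedState ψ) m (1 / 3))) :
    1 / 144 * (m : ℝ) ≤ alg.queries := by
  have hx : (⟨0, by lia⟩ : Fin a) ≠ ⟨1, by lia⟩ := by simp
  have hy : (⟨0, by lia⟩ : Fin d) ≠ ⟨1, by lia⟩ := by simp
  have hpq : ((⟨0, by lia⟩ : Fin a), (⟨0, by lia⟩ : Fin d)) ≠ (⟨1, by lia⟩, ⟨1, by lia⟩) :=
    fun heq => hx (Prod.ext_iff.1 heq).1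
  have hunit := isUnitVector_planeVec hpq
  have hdistinguish := alg.outputProb_add_outputProb_le (hunit (2 * hardAngle m)) (hunit 0)
    (disjoint_strictlyWithin_planeVec hx hy hm)
  rw [star_planeVec_dotProduct_planeVec hpq, sub_zero, cos_two_mul_hardAngle,
    ← Complex.ofReal_pow, Complex.ofReal_re] at hdistinguish
  have hsqrt : 1 / 6 ≤ √(2 * (1 - (1 - 2 / m : ℝ) ^ alg.queries)) := by
    linarith [h _ (hunit (2 * hardAngle m)), h _ (hunit 0)]
  have hoverlap : 1 / 36 ≤ 2 * (1 - (1 - 2 / m : ℝ) ^ alg.queries) := by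
    rw [Real.le_sqrt' (by norm_num)] at hsqrt
    linarith
  have hm' : (20 : ℝ) ≤ m := by exact_mod_cast hm
  have hbernoulli : 1 + alg.queries * (-(2 / m)) ≤ (1 - 2 / m : ℝ) ^ alg.queries := by
    rw [sub_eq_add_neg]
    refine one_add_mul_le_pow ?_ _
    rw [neg_le_neg_iff, div_le_iff₀ (by linarith)]
    linarith
  have hm_inv : 1 / 144 ≤ (alg.queries : ℝ) / m := by
    linarith [show (alg.queries : ℝ) * -(2 / m) = -(2 * (alg.queries / m)) by ring]
  rwa [le_div_iff₀ (by linarith)] at hm_inv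

open scoped Matrix.Norms.Frobenius in
lemma UnitaryAlgorithm.le_queries {a d m : ℕ} [NeZero a] [NeZero d] (ha : 2 ≤ a) (hd : 2 ≤ d)
    (hm : 20 ≤ m) (alg : UnitaryAlgorithm a d)
    (h : ∀ U ∈ unitaryGroup (Fin a × Fin d) ℂ,
      2 / 3 ≤ alg.outputProb U (strictlyWithin (reducedState (preparedState U)) m (1 / 3))) :
    1 / 18 * √(m : ℝ) ≤ alg.queries := by
  have hx : (0 : Fin a) ≠ ⟨1, by lia⟩ := by simp [Fin.ext_iff]
  have hy : (0 : Fin d) ≠ ⟨1, by lia⟩ := by simp [Fin.ext_iff]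
  have hpq : ((0 : Fin a), (0 : Fin d)) ≠ (⟨1, by lia⟩, ⟨1, by lia⟩) :=
    fun heq => hx (Prod.ext_iff.1 heq).1
  let R (θ : ℝ) := reflection (planeVec ((0 : Fin a), (0 : Fin d)) (⟨1, by lia⟩, ⟨1, by lia⟩) θ)
  have hR (θ : ℝ) : R θ ∈ unitaryGroup (Fin a × Fin d) ℂ :=
    reflection_mem_unitaryGroup (isUnitVector_planeVec hpq θ)
  have hprepared (θ : ℝ) : preparedState (R θ) = planeVec (0, 0) _ (2 * θ) :=
    reflection_planeVec_mulVec_single hpq θ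
  have hprob (θ : ℝ) := hprepared θ ▸ h _ (hR θ)
  have hdistinguish := alg.outputProb_add_outputProb_le (hR (hardAngle m)) (hR 0)
    (disjoint_strictlyWithin_planeVec hx hy hm)
  have hdrift : 1 / 6 ≤ alg.queries * ‖R (hardAngle m) - R 0‖ := by
    have hprob_zero := hprob 0
    rw [mul_zero] at hprob_zero
    linarith [hprob (hardAngle m)]
  have hdist : ‖R (hardAngle m) - R 0‖ * √(m : ℝ) ≤ 3 := by
    have hm0 : (m : ℝ) ≠ 0 := by norm_cast; lia
    refine le_of_sq_le_sq ?_ (by norm_num)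
    rw [mul_pow, norm_reflection_planeVec_sub_reflection_sq hpq, sub_zero, sin_hardAngle_sq,
      Real.sq_sqrt (by positivity), mul_assoc, one_div_mul_cancel hm0]
    norm_num
  calc 1 / 18 * √(m : ℝ) = 1 / 3 * (1 / 6 * √(m : ℝ)) := by ring
    _ ≤ 1 / 3 * (alg.queries * ‖R (hardAngle m) - R 0‖ * √(m : ℝ)) := by gcongr
    _ ≤ 1 / 3 * (alg.queries * 3) := by rw [mul_assoc]; gcongr
    _ = alg.queries := by ring

/-! ### Measuring an observable on many copies -/

section reindex

variable {ι ι' κ κ' : Type*} [Fintype ι] [Fintype ι']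

lemma submatrix_mulVec_comp (A : Matrix κ ι ℂ) (f : κ' → κ) (e : ι' ≃ ι) (v : ι → ℂ) :
    A.submatrix f e *ᵥ (v ∘ e) = (A *ᵥ v) ∘ f := by
  rw [submatrix_mulVec_equiv, Function.comp_assoc, Equiv.self_comp_symm, Function.comp_id]

lemma sqNorm_submatrix_mulVec_sub_smul (A : Matrix ι ι ℂ) (e : ι' ≃ ι) (v : ι → ℂ) (c : ℂ) :
    sqNorm (A.submatrix e e *ᵥ (v ∘ e) - c • (v ∘ e)) = sqNorm (A *ᵥ v - c • v) := by
  rw [submatrix_mulVec_comp, ← sqNorm_comp_equiv e (A *ᵥ v - c • v)]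
  rfl

end reindex

section discard

variable {ι ξ κ : Type*} [Fintype ι] [DecidableEq ι] [Fintype ξ] [DecidableEq ξ] [Fintype κ]
  [DecidableEq κ]

/-- The channel that splits a system into two factors along `e` and discards the first one. -/
def Channel.discard (e : ι ≃ ξ × κ) : Channel ι κ where
  num := Fintype.card ξ
  kraus x := (1 : Matrix (ξ × κ) (ξ × κ) ℂ).submatrix ((Fintype.equivFin ξ).symm x, ·) e
  complete := by
    rw [(Fintype.equivFin ξ).symm.sum_comp fun x => ((1 : Matrix (ξ × κ) (ξ × κ) ℂ).submatrix
      (x, ·) e)ᴴ * (1 : Matrix (ξ × κ) (ξ × κ) ℂ).submatrix (x, ·) e]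
    ext i j
    simp only [Matrix.sum_apply, mul_apply, conjTranspose_apply, submatrix_apply,
      ← Fintype.sum_prod_type']
    simp [one_apply, eq_comm (a := j)]

lemma Channel.discard_apply_ketBra (e : ι ≃ ξ × κ) (v : ι → ℂ) :
    (Channel.discard e).apply (ketBra v) = ∑ x, ketBra fun k => v (e.symm (x, k)) := by
  rw [← (Fintype.equivFin ξ).symm.sum_comp]
  refine Finset.sum_congr rfl fun x _ => ?_
  rw [mul_ketBra_mul]
  congr 1
  exact (submatrix_mulVec_equiv _ _ _ _).trans (by rw [one_mulVec]; rfl)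

end discard

section store

variable {I κ : Type*} [DecidableEq I]

/-- The involution that exchanges the last system with the system in slot `i`. -/
def slotSwap (κ : Type*) (i : I) : Equiv.Perm ((I → κ) × κ) where
  toFun p := (Function.update p.1 i p.2, p.1 i)
  invFun p := (Function.update p.1 i p.2, p.1 i)
  left_inv p := by simp
  right_inv p := by simp

/-- The bijection that, in a memory with basis `W` consisting of slots indexed by `I`, puts a new
system into slot `i` and takes out the old one. -/
def storeEquiv {W : Type*} (e : W ≃ (I → κ)) (i : I) : W × κ ≃ κ × W :=
  ((e.prodCongr (Equiv.refl κ)).trans (slotSwap κ i)).trans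
    ((e.symm.prodCongr (Equiv.refl κ)).trans (Equiv.prodComm W κ))

lemma storeEquiv_symm_apply {W : Type*} (e : W ≃ (I → κ)) (i : I) (x : κ) (y : W) :
    (storeEquiv e i).symm (x, y) = (e.symm (Function.update (e y) i x), e y i) := rfl

lemma copyOracle_ketBra {ι : Type*} (ψ : κ → ℂ) (v : ι → ℂ) :
    copyOracle ψ (ketBra v) = ketBra fun p => v p.1 * ψ p.2 := by
  ext p q
  simp only [copyOracle, ketBra, kroneckerMap_apply, vecMulVec_apply, Pi.star_apply, star_mul',
    mul_mul_mul_comm]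

variable [Fintype I] [Fintype κ] [DecidableEq κ] {W : Type*} [Fintype W] [DecidableEq W]
  (e : W ≃ (I → κ))

lemma discard_storeEquiv_apply_copyOracle (v : I → κ → ℂ) {i : I} (hi : IsUnitVector (v i))
    (ψ : κ → ℂ) :
    (Channel.discard (storeEquiv e i)).apply (copyOracle ψ (ketBra (piVec v ∘ e)))
      = ketBra (piVec (Function.update v i ψ) ∘ e) := by
  have hstored (x : κ) :
      (fun y => piVec v (e ((storeEquiv e i).symm (x, y)).1) * ψ ((storeEquiv e i).symm (x, y)).2)
        = v i x • (piVec (Function.update v i ψ) ∘ e) := by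
    ext y
    have hsplit := piVec_update_apply v i (v i) (Function.update (e y) i x)
    rw [Function.update_eq_self, Function.update_self, Finset.prod_congr rfl fun j hj => by
      rw [Function.update_of_ne (Finset.ne_of_mem_erase hj)]] at hsplit
    simp only [storeEquiv_symm_apply, Equiv.apply_symm_apply, Pi.smul_apply, smul_eq_mul,
      Function.comp_apply, hsplit, piVec_update_apply]
    ring
  have hscale (x : κ) : ketBra (v i x • (piVec (Function.update v i ψ) ∘ e))
      = (star (v i x) * v i x) • ketBra (piVec (Function.update v i ψ) ∘ e) := by
    simp only [ketBra, star_smul, smul_vecMulVec, vecMulVec_smul, smul_smul, mul_comm]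
  rw [copyOracle_ketBra, Channel.discard_apply_ketBra]
  refine (Finset.sum_congr rfl fun x _ =>
    (congrArg ketBra (hstored x)).trans (hscale x)).trans ?_
  rw [← Finset.sum_smul]
  exact (congrArg (· • ketBra _) hi).trans (one_smul ℂ _)

lemma foldl_discard_storeEquiv (l : List I) {ψ : κ → ℂ} (hψ : IsUnitVector ψ) {v : I → κ → ℂ}
    (hv : ∀ i, IsUnitVector (v i)) :
    l.foldl (fun σ i => (Channel.discard (storeEquiv e i)).apply (copyOracle ψ σ))
        (ketBra (piVec v ∘ e))
      = ketBra (piVec (fun i => if i ∈ l then ψ else v i) ∘ e) := by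
  induction l generalizing v with
  | nil => simp only [List.foldl_nil, List.not_mem_nil, if_false]
  | cons i l ih =>
    have hv' : ∀ j, IsUnitVector (Function.update v i ψ j) :=
      (Function.forall_update_iff v fun _ x => IsUnitVector x).2 ⟨hψ, fun j _ => hv j⟩
    rw [List.foldl_cons, discard_storeEquiv_apply_copyOracle e v (hv i), ih hv']
    congr 3
    ext1 j
    by_cases hj : j = i <;> simp [hj]

end store

lemma CopyAlgorithm.exists_const (a d : ℕ) (c : ℝ) :
    ∃ alg : CopyAlgorithm a d, alg.queries = 0 ∧ ∀ ψ S, c ∈ S → alg.outputProb ψ S = 1 := by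
  refine ⟨⟨1, 1, ⟨PosSemidef.one, by simp⟩, [], ⟨1, fun _ => 1, fun _ => PosSemidef.one, by simp,
    fun _ => c⟩⟩, rfl, fun ψ S hS => ?_⟩
  simp [outputProb, finalState, Measurement.prob, hS]

lemma CopyAlgorithm.exists_measure {I Y : Type*} [Fintype I] [Fintype Y] {a d : ℕ}
    [NeZero a] [NeZero d] (e : Y ≃ (I → Fin a × Fin d)) {A : Matrix Y Y ℂ} (hA : A.IsHermitian) :
    ∃ alg : CopyAlgorithm a d, alg.queries = Fintype.card I ∧
      ∀ ψ : Fin a × Fin d → ℂ, IsUnitVector ψ → ∀ (μ ε : ℝ), 0 < ε →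
        1 - sqNorm (A *ᵥ (piVec (fun _ => ψ) ∘ e) - (μ : ℂ) • (piVec (fun _ => ψ) ∘ e)) / ε ^ 2
          ≤ alg.outputProb ψ (Metric.closedBall μ ε) := by
  classical
  let r : Fin (Fintype.card Y) ≃ Y := (Fintype.equivFin Y).symm
  let blank : I → Fin a × Fin d → ℂ := fun _ => Pi.single (0, 0) 1
  have hblank (i : I) : IsUnitVector (blank i) := isUnitVector_single (0, 0)
  have hAr := hA.submatrix r
  refine ⟨⟨_, ketBra (piVec blank ∘ r.trans e),
    isDensity_ketBra ((IsUnitVector.piVec hblank).comp_equiv _),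
    Finset.univ.toList.map fun i => Channel.discard (storeEquiv (r.trans e) i),
    spectralMeasurement hAr⟩, by simp [queries], fun ψ hψ μ ε hε => ?_⟩
  have hunit : IsUnitVector (piVec (fun _ : I => ψ) ∘ e) :=
    (IsUnitVector.piVec fun _ => hψ).comp_equiv e
  have hcheb := one_sub_le_spectralMeasurement_prob_closedBall hAr (hunit.comp_equiv r) μ hε
  rw [sqNorm_submatrix_mulVec_sub_smul] at hcheb
  rw [outputProb, finalState, List.foldl_map, foldl_discard_storeEquiv _ _ hψ hblank]
  simp only [Finset.mem_toList, Finset.mem_univ, if_true]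
  exact hcheb

/-! ### The upper bound for the copy-producing oracle -/

section blockAverage

variable {X : Type*} [Fintype X] [DecidableEq X] {I : Type*} [Fintype I] [DecidableEq I]

variable (I) in
/-- The average of the observable `H` over `I` copies of a system. -/
def blockAverage (H : Matrix X X ℂ) : Matrix (I → X) (I → X) ℂ :=
  (Fintype.card I : ℂ)⁻¹ • ∑ i, piTensor I X (Pi.mulSingle i H)

lemma isHermitian_blockAverage {H : Matrix X X ℂ} (hH : H.IsHermitian) :
    (blockAverage I H).IsHermitian := by
  have hsingle (i : I) : (fun j => ((Pi.mulSingle i H : I → Matrix X X ℂ) j)ᴴ)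
      = Pi.mulSingle i H := by
    ext1 j
    by_cases hj : j = i
    · rw [hj, Pi.mulSingle_eq_same, hH.eq]
    · rw [Pi.mulSingle_eq_of_ne hj, conjTranspose_one]
  rw [IsHermitian, blockAverage, conjTranspose_smul, conjTranspose_sum]
  simp only [conjTranspose_piTensor, hsingle, star_inv₀, star_natCast]

lemma piTensor_mulSingle_mulVec_piVec_sub_smul (H : Matrix X X ℂ) (φ : X → ℂ) (c : ℂ) (i : I) :
    piTensor I X (Pi.mulSingle i H) *ᵥ piVec (fun _ => φ) - c • piVec (fun _ => φ)
      = piVec (Function.update (fun _ => φ) i (H *ᵥ φ - c • φ)) := by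
  have hupdate : (fun j => (Pi.mulSingle i H : I → Matrix X X ℂ) j *ᵥ φ)
      = Function.update (fun _ => φ) i (H *ᵥ φ) := by
    ext1 j
    by_cases hj : j = i <;> simp [hj]
  have hself : piVec (fun _ : I => φ) = piVec (Function.update (fun _ => φ) i φ) := by
    rw [Function.update_eq_self]
  rw [piTensor_mulVec_piVec, hupdate, hself]
  ext w
  simp only [Pi.sub_apply, Pi.smul_apply, smul_eq_mul, piVec_update_apply]
  ring

lemma blockAverage_mulVec_piVec_sub_smul [Nonempty I] (H : Matrix X X ℂ) (φ : X → ℂ) (c : ℂ) :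
    blockAverage I H *ᵥ piVec (fun _ => φ) - c • piVec (fun _ => φ)
      = (Fintype.card I : ℂ)⁻¹ •
        ∑ i, piVec (Function.update (fun _ : I => φ) i (H *ᵥ φ - c • φ)) := by
  have hcard : (Fintype.card I : ℂ) ≠ 0 := Nat.cast_ne_zero.2 Fintype.card_ne_zero
  simp only [← piTensor_mulSingle_mulVec_piVec_sub_smul, Finset.sum_sub_distrib, Finset.sum_const,
    Finset.card_univ, smul_sub, blockAverage, smul_mulVec, sum_mulVec]
  rw [← Nat.cast_smul_eq_nsmul ℂ, inv_smul_smul₀ hcard]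

/-- The variance of an average of independent copies: the deviations of different copies are
orthogonal. -/
lemma sqNorm_blockAverage_mulVec_piVec_sub_smul [Nonempty I] (H : Matrix X X ℂ) {φ : X → ℂ}
    (hφ : IsUnitVector φ) {c : ℂ} (hc : star φ ⬝ᵥ (H *ᵥ φ) = c) :
    sqNorm (blockAverage I H *ᵥ piVec (fun _ => φ) - c • piVec (fun _ => φ))
      = sqNorm (H *ᵥ φ - c • φ) / Fintype.card I := by
  have hcard : (Fintype.card I : ℝ) ≠ 0 := Nat.cast_ne_zero.2 Fintype.card_ne_zero
  have hmean : star φ ⬝ᵥ (H *ᵥ φ - c • φ) = 0 := by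
    rw [dotProduct_sub, hc, dotProduct_smul, hφ, smul_eq_mul, mul_one, sub_self]
  have horth : ∀ i j : I, i ≠ j →
      star (piVec (Function.update (fun _ => φ) i (H *ᵥ φ - c • φ)))
        ⬝ᵥ piVec (Function.update (fun _ => φ) j (H *ᵥ φ - c • φ)) = 0 := by
    intro i j hij
    rw [star_piVec_dotProduct_piVec]
    refine Finset.prod_eq_zero (Finset.mem_univ j) ?_
    rw [Function.update_self, Function.update_of_ne hij.symm, hmean]
  have hsingle (i : I) : sqNorm (piVec (Function.update (fun _ => φ) i (H *ᵥ φ - c • φ)))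
      = sqNorm (H *ᵥ φ - c • φ) := by
    rw [sqNorm_piVec, Finset.prod_eq_single i, Function.update_self]
    · intro j _ hj
      rw [Function.update_of_ne hj, hφ.sqNorm_eq_one]
    · simp
  rw [blockAverage_mulVec_piVec_sub_smul, sqNorm_smul, sqNorm_sum_of_orthogonal horth]
  simp only [hsingle, Finset.sum_const, Finset.card_univ, nsmul_eq_mul, norm_inv,
    Complex.norm_natCast]
  field_simp

end blockAverage

section cyclicObservable

variable {α β : Type*} [DecidableEq α] [DecidableEq β]

/-- The Hermitian part of the cyclic permutation of the second components of `m` registers. Its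
mean in the state `|ψ⟩^{⊗m}` is `Tr (ρ ^ m)`. -/
def cyclicObservable (α β : Type*) [DecidableEq α] [DecidableEq β] (m : ℕ) :
    Matrix (Fin m → α × β) (Fin m → α × β) ℂ :=
  (1 / 2 : ℂ) • (Equiv.Perm.permMatrix ℂ (permuteB (finRotate m))
    + Equiv.Perm.permMatrix ℂ (permuteB (finRotate m)).symm)

lemma isHermitian_cyclicObservable (m : ℕ) : (cyclicObservable α β m).IsHermitian := by
  rw [IsHermitian, cyclicObservable, conjTranspose_smul, conjTranspose_add,
    conjTranspose_permMatrix, conjTranspose_permMatrix, add_comm]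
  simp [Equiv.Perm.inv_def]

variable [Fintype α] [Fintype β]

lemma cyclicObservable_mulVec (m : ℕ) (v : (Fin m → α × β) → ℂ) :
    cyclicObservable α β m *ᵥ v = (1 / 2 : ℂ) • (v ∘ permuteB (finRotate m)
      + v ∘ (permuteB (finRotate m)).symm) := by
  rw [cyclicObservable, smul_mulVec, add_mulVec, permMatrix_mulVec, permMatrix_mulVec]

lemma sqNorm_cyclicObservable_mulVec_le (m : ℕ) (v : (Fin m → α × β) → ℂ) :
    sqNorm (cyclicObservable α β m *ᵥ v) ≤ sqNorm v := by
  have hadd := sqNorm_add_le (v ∘ permuteB (finRotate m)) (v ∘ (permuteB (finRotate m)).symm)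
  rw [sqNorm_comp_equiv, sqNorm_comp_equiv] at hadd
  rw [cyclicObservable_mulVec, sqNorm_smul]
  norm_num
  linarith

variable {ψ : α × β → ℂ} {m : ℕ}

lemma star_dotProduct_cyclicObservable_mulVec (ψ : α × β → ℂ) (hm : m ≠ 0) :
    star (piVec fun _ : Fin m => ψ) ⬝ᵥ (cyclicObservable α β m *ᵥ piVec fun _ => ψ)
      = powerTrace (reducedState ψ) m := by
  rw [cyclicObservable_mulVec, dotProduct_smul, dotProduct_add,
    star_piVec_dotProduct_comp_permuteB_finRotate ψ hm,
    star_piVec_dotProduct_comp_permuteB_finRotate_symm ψ hm, smul_eq_mul]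
  ring

lemma sqNorm_cyclicObservable_mulVec_sub_smul_le (hψ : IsUnitVector ψ) (hm : m ≠ 0) :
    sqNorm (cyclicObservable α β m *ᵥ piVec (fun _ => ψ)
        - (powerTrace (reducedState ψ) m : ℂ) • piVec fun _ => ψ)
      ≤ 1 - powerTrace (reducedState ψ) m ^ 2 := by
  have hunit : IsUnitVector (piVec fun _ : Fin m => ψ) := IsUnitVector.piVec fun _ => hψ
  rw [sqNorm_mulVec_sub_smul (isHermitian_cyclicObservable m) hunit
    (star_dotProduct_cyclicObservable_mulVec ψ hm), ← hunit.sqNorm_eq_one]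
  gcongr
  exact sqNorm_cyclicObservable_mulVec_le m _

omit [DecidableEq α] in
lemma abs_powerTrace_reducedState_le_one (hψ : IsUnitVector ψ) (hm : m ≠ 0) :
    |powerTrace (reducedState ψ) m| ≤ 1 := by
  classical
  exact (sq_le_one_iff_abs_le_one _).1 <| sub_nonneg.1 <|
    (sqNorm_nonneg _).trans (sqNorm_cyclicObservable_mulVec_sub_smul_le hψ hm)

omit [DecidableEq α] in
lemma exists_forall_mem_within {ε : ℝ} (hε : 0 < ε) (h : m = 0 ∨ 1 ≤ ε) :
    ∃ c, ∀ ψ : α × β → ℂ, IsUnitVector ψ → c ∈ within (reducedState ψ) m ε := by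
  simp only [within_reducedState, Metric.mem_closedBall, Real.dist_eq]
  by_cases hm : m = 0
  · refine ⟨Fintype.card β, fun ψ _ => ?_⟩
    simp [hm, powerTrace, hε.le]
  · refine ⟨0, fun ψ hψ => ?_⟩
    rw [zero_sub, abs_neg]
    exact (abs_powerTrace_reducedState_le_one hψ hm).trans (h.resolve_left hm)

end cyclicObservable

lemma CopyAlgorithm.exists_estimator (a d : ℕ) [NeZero a] [NeZero d] {k m : ℕ} (hk : k ≠ 0)
    (hm : m ≠ 0) :
    ∃ alg : CopyAlgorithm a d, alg.queries = k * m ∧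
      ∀ ψ : Fin a × Fin d → ℂ, IsUnitVector ψ → ∀ ε : ℝ, 0 < ε →
        1 - 1 / (k * ε ^ 2) ≤ alg.outputProb ψ (within (reducedState ψ) m ε) := by
  have : NeZero k := ⟨hk⟩
  obtain ⟨alg, hqueries, hprob⟩ := exists_measure
    (Equiv.curry (Fin k) (Fin m) (Fin a × Fin d)).symm
    (isHermitian_blockAverage (isHermitian_cyclicObservable m))
  refine ⟨alg, by rw [hqueries, Fintype.card_prod, Fintype.card_fin, Fintype.card_fin],
    fun ψ hψ ε hε => ?_⟩
  have hcurry : piVec (fun _ : Fin k × Fin m => ψ) ∘ (Equiv.curry (Fin k) (Fin m) _).symm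
      = piVec fun _ => piVec fun _ => ψ := by
    ext w
    exact Fintype.prod_prod_type _
  have hspread := sqNorm_blockAverage_mulVec_piVec_sub_smul (I := Fin k) _
    (IsUnitVector.piVec fun _ => hψ) (star_dotProduct_cyclicObservable_mulVec ψ hm)
  have hvariance : sqNorm (cyclicObservable (Fin a) (Fin d) m *ᵥ piVec (fun _ => ψ)
      - (powerTrace (reducedState ψ) m : ℂ) • piVec fun _ => ψ) ≤ 1 :=
    (sqNorm_cyclicObservable_mulVec_sub_smul_le hψ hm).trans (sub_le_self 1 (sq_nonneg _))
  have hmeasured := hprob ψ hψ (powerTrace (reducedState ψ) m) ε hε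
  rw [hcurry, hspread, Fintype.card_fin, div_div] at hmeasured
  rw [within_reducedState]
  refine le_trans ?_ hmeasured
  gcongr

theorem CopyAlgorithm.exists_queries_le (a d m : ℕ) {ε : ℝ} (hε : 0 < ε) :
    ∃ alg : CopyAlgorithm a d, (alg.queries : ℝ) ≤ 5 * (m / ε ^ 2) ∧
      ∀ ψ : Fin a × Fin d → ℂ, IsUnitVector ψ →
        2 / 3 < alg.outputProb ψ (within (reducedState ψ) m ε) := by
  by_cases htriv : m = 0 ∨ 1 ≤ ε
  · obtain ⟨c, hc⟩ := exists_forall_mem_within (α := Fin a) (β := Fin d) hε htriv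
    obtain ⟨alg, hqueries, hprob⟩ := exists_const a d c
    refine ⟨alg, by rw [hqueries, Nat.cast_zero]; positivity, fun ψ hψ => ?_⟩
    rw [hprob ψ _ (hc ψ hψ)]
    norm_num
  rcases isEmpty_or_nonempty (Fin a × Fin d) with hempty | ⟨x, y⟩
  · obtain ⟨alg, hqueries, -⟩ := exists_const a d 0
    refine ⟨alg, by rw [hqueries, Nat.cast_zero]; positivity, fun ψ hψ => ?_⟩
    simp [IsUnitVector] at hψ
  have : NeZero a := ⟨x.pos.ne'⟩
  have : NeZero d := ⟨y.pos.ne'⟩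
  obtain ⟨hm, hε1⟩ := not_or.1 htriv
  have hlower : 4 / ε ^ 2 ≤ ⌈4 / ε ^ 2⌉₊ := Nat.le_ceil _
  have hupper : (⌈4 / ε ^ 2⌉₊ : ℝ) < 4 / ε ^ 2 + 1 := Nat.ceil_lt_add_one (by positivity)
  have hone : 1 ≤ 1 / ε ^ 2 := by
    rw [one_le_div (by positivity)]
    exact pow_le_one₀ hε.le (not_le.1 hε1).le
  obtain ⟨alg, hqueries, hprob⟩ :=
    exists_estimator a d (Nat.ceil_pos.2 (show 0 < 4 / ε ^ 2 by positivity)).ne' hm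
  refine ⟨alg, ?_, fun ψ hψ => lt_of_lt_of_le ?_ (hprob ψ hψ ε hε)⟩
  · calc (alg.queries : ℝ) = ⌈4 / ε ^ 2⌉₊ * m := by rw [hqueries, Nat.cast_mul]
      _ ≤ (4 / ε ^ 2 + 1 / ε ^ 2) * m := by gcongr; linarith
      _ = 5 * (m / ε ^ 2) := by ring
  · have hfail : 1 / (⌈4 / ε ^ 2⌉₊ * ε ^ 2) ≤ 1 / 4 := by
      gcongr
      exact (div_le_iff₀ (by positivity)).1 hlower
    linarith

/-! ### Circuits with plain oracle calls -/

section circuits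

variable {R : Type*} [Fintype R] [DecidableEq R]

lemma submatrix_mem_unitaryGroup {R' : Type*} [Fintype R'] [DecidableEq R'] {U : Matrix R R ℂ}
    (hU : U ∈ unitaryGroup R ℂ) (e : R' ≃ R) : U.submatrix e e ∈ unitaryGroup R' ℂ := by
  rw [mem_unitaryGroup_iff, star_eq_conjTranspose, conjTranspose_submatrix, submatrix_mul_equiv,
    ← star_eq_conjTranspose, mem_unitaryGroup_iff.1 hU, submatrix_one_equiv]

lemma permMatrix_mem_unitaryGroup (σ : Equiv.Perm R) :
    Equiv.Perm.permMatrix ℂ σ ∈ unitaryGroup R ℂ := by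
  rw [mem_unitaryGroup_iff, star_eq_conjTranspose, conjTranspose_permMatrix, ← permMatrix_mul,
    inv_mul_cancel, permMatrix_one]

/-- The channel `σ ↦ U σ U†`. -/
def Channel.ofUnitary {U : Matrix R R ℂ} (hU : U ∈ unitaryGroup R ℂ) : Channel R R where
  num := 1
  kraus _ := U
  complete := by rw [Fin.sum_univ_one, ← star_eq_conjTranspose, mem_unitaryGroup_iff'.1 hU]

lemma Channel.ofUnitary_apply {U : Matrix R R ℂ} (hU : U ∈ unitaryGroup R ℂ) (σ : Matrix R R ℂ) :
    (Channel.ofUnitary hU).apply σ = U * σ * Uᴴ :=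
  Fin.sum_univ_one _

/-- The admissible unitary oracles on `ℂ^a ⊗ ℂ^d`. -/
abbrev UnitaryOracle (a d : ℕ) : Type := unitaryGroup (Fin a × Fin d) ℂ

variable {a d w : ℕ} {Ω : Type*} [Fintype Ω]

/-- The matrix of an oracle call without control, with respect to a basis `Ω` of the register. -/
def plainCall (e : Ω ≃ Register w a d) (inverse : Bool) (U : UnitaryOracle a d) : Matrix Ω Ω ℂ :=
  ((⟨inverse, false⟩ : OracleCall).toMatrix w U).submatrix e e

lemma plainCall_mulVec_comp_symm (e : Ω ≃ Register w a d) (inverse : Bool) (U : UnitaryOracle a d)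
    (v : Ω → ℂ) :
    (plainCall e inverse U *ᵥ v) ∘ e.symm
      = (⟨inverse, false⟩ : OracleCall).toMatrix w U *ᵥ (v ∘ e.symm) := by
  rw [← submatrix_mulVec_comp _ e.symm e.symm, plainCall, submatrix_submatrix,
    Equiv.self_comp_symm, submatrix_id_id]

variable [DecidableEq Ω]

lemma plainCall_mem_unitaryGroup (e : Ω ≃ Register w a d) (inverse : Bool)
    (U : UnitaryOracle a d) : plainCall e inverse U ∈ unitaryGroup Ω ℂ :=
  submatrix_mem_unitaryGroup (OracleCall.toMatrix_mem_unitaryGroup _ w U.2) e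

/-- `Prepares e q v`: with `q` calls without control to the oracle `U` or its inverse, and gates
that do not depend on `U`, one can prepare the pure state `v U` of the register. -/
inductive Prepares (e : Ω ≃ Register w a d) : ℕ → (UnitaryOracle a d → Ω → ℂ) → Prop
  | init {x : Ω → ℂ} (hx : IsUnitVector x) : Prepares e 0 fun _ => x
  | query {q : ℕ} {v : UnitaryOracle a d → Ω → ℂ} (inverse : Bool) {A : Matrix Ω Ω ℂ}
      (hA : A ∈ unitaryGroup Ω ℂ) (h : Prepares e q v) :
      Prepares e (q + 1) fun U => A *ᵥ (plainCall e inverse U *ᵥ v U)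

/-- `Implements e r F`: with `r` calls without control one can apply the operator `F U` to any
state of the register that has been prepared before. -/
def Implements (e : Ω ≃ Register w a d) (r : ℕ) (F : UnitaryOracle a d → Matrix Ω Ω ℂ) : Prop :=
  ∀ ⦃q v⦄, Prepares e q v → Prepares e (q + r) fun U => F U *ᵥ v U

variable {e : Ω ≃ Register w a d} {q r s : ℕ} {v : UnitaryOracle a d → Ω → ℂ}
  {F G : UnitaryOracle a d → Matrix Ω Ω ℂ}

lemma Implements.congr (hF : Implements e r F) (h : ∀ U, F U = G U) : Implements e r G :=
  funext h ▸ hF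

lemma Implements.gate {A : Matrix Ω Ω ℂ} (hA : A ∈ unitaryGroup Ω ℂ) :
    Implements e 0 fun _ => A := by
  intro q v hv
  cases hv with
  | init hx => exact .init (hx.unitary_mulVec hA)
  | query inverse hA' hv =>
    simp only [mulVec_mulVec _ A]
    exact .query inverse (mul_mem hA hA') hv

lemma Implements.plainCall (inverse : Bool) :
    Implements e 1 fun U => plainCall e inverse U := by
  intro q v hv
  simpa only [one_mulVec] using Prepares.query inverse (one_mem _) hv

lemma Implements.mul (hF : Implements e r F) (hG : Implements e s G) :
    Implements e (s + r) fun U => F U * G U := by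
  intro q v hv
  simp only [← mulVec_mulVec, ← add_assoc]
  exact hF (hG hv)

lemma Prepares.isUnitVector (h : Prepares e q v) (U : UnitaryOracle a d) :
    IsUnitVector (v U) := by
  induction h with
  | init hx => exact hx
  | query inverse hA _ ih =>
    exact (ih.unitary_mulVec (plainCall_mem_unitaryGroup e inverse U)).unitary_mulVec hA

lemma Prepares.exists_steps (h : Prepares e q v) :
    ∃ (start : Matrix (Register w a d) (Register w a d) ℂ)
      (steps : List (OracleCall × Channel (Register w a d) (Register w a d))),
      IsDensity start ∧ steps.length = q ∧ (∀ s ∈ steps, s.1.controlled = false) ∧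
      ∀ U : UnitaryOracle a d, steps.foldl
        (fun σ s => s.2.apply (s.1.toMatrix w U * σ * (s.1.toMatrix w (U : Matrix _ _ ℂ))ᴴ)) start
          = ketBra (v U ∘ e.symm) := by
  induction h with
  | @init x hx =>
    exact ⟨ketBra (x ∘ e.symm), [], isDensity_ketBra (hx.comp_equiv _), rfl, by simp,
      fun _ => rfl⟩
  | query inverse hA _ ih =>
    obtain ⟨start, steps, hstart, hlength, hplain, hfold⟩ := ih
    refine ⟨start, steps ++ [(⟨inverse, false⟩,
      Channel.ofUnitary (submatrix_mem_unitaryGroup hA e.symm))], hstart, by simp [hlength], ?_,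
      fun U => ?_⟩
    · simpa [or_imp, forall_and] using hplain
    · rw [List.foldl_append, hfold U, List.foldl_cons, List.foldl_nil, mul_ketBra_mul,
        Channel.ofUnitary_apply, mul_ketBra_mul, ← plainCall_mulVec_comp_symm,
        submatrix_mulVec_comp]

lemma Prepares.exists_measure (h : Prepares e q v) {A : Matrix Ω Ω ℂ} (hA : A.IsHermitian) :
    ∃ alg : UnitaryAlgorithm a d, alg.queries = q ∧ alg.UsesPlainCalls ∧
      ∀ (U : UnitaryOracle a d) (μ ε : ℝ), 0 < ε →
        1 - sqNorm (A *ᵥ v U - (μ : ℂ) • v U) / ε ^ 2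
          ≤ alg.outputProb U (Metric.closedBall μ ε) := by
  obtain ⟨start, steps, hstart, hlength, hplain, hfold⟩ := h.exists_steps
  have hAe := hA.submatrix e.symm
  refine ⟨⟨w, start, hstart, steps, spectralMeasurement hAe⟩, hlength, hplain,
    fun U μ ε hε => ?_⟩
  have hcheb := one_sub_le_spectralMeasurement_prob_closedBall hAe
    ((h.isUnitVector U).comp_equiv e.symm) μ hε
  rw [sqNorm_submatrix_mulVec_sub_smul, ← hfold U] at hcheb
  exact hcheb

end circuits

/-! ### Oracle calls on several systems -/

section blockDiagonal

variable {R T : Type*} [Fintype R] [Fintype T] [DecidableEq T]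

lemma blockDiagonal_mulVec_apply (M : T → Matrix R R ℂ) (v : R × T → ℂ) (r : R) (t : T) :
    (blockDiagonal M *ᵥ v) (r, t) = (M t *ᵥ fun r' => v (r', t)) r := by
  simp [mulVec, dotProduct, Fintype.sum_prod_type, blockDiagonal_apply, ite_mul]

variable [DecidableEq R]

lemma blockDiagonal_mem_unitaryGroup {M : T → Matrix R R ℂ}
    (hM : ∀ t, M t ∈ unitaryGroup R ℂ) : blockDiagonal M ∈ unitaryGroup (R × T) ℂ := by
  rw [mem_unitaryGroup_iff, star_eq_conjTranspose, blockDiagonal_conjTranspose,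
    ← blockDiagonal_mul, ← blockDiagonal_one]
  exact congrArg blockDiagonal (funext fun t => mem_unitaryGroup_iff.1 (hM t))

end blockDiagonal

section parallel

/-- Basis of a control qubit, a family of systems indexed by `I`, and an auxiliary system. The
auxiliary system is the target of the oracle calls. -/
abbrev Cell (I κ : Type*) : Type _ := Fin 2 × (I → κ) × κ

variable {I κ T : Type*}

/-- Shortcut without which the instance search exceeds its size limit. -/
instance Cell.instDecidableEq [Fintype I] [DecidableEq κ] : DecidableEq (Cell I κ) :=
  instDecidableEqProd

variable [DecidableEq I]

/-- Exchange the `i`-th system of a cell with the auxiliary system. -/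
def cellSwap (κ T : Type*) (i : I) : Equiv.Perm (Cell I κ × T) :=
  ((Equiv.refl (Fin 2)).prodCongr (slotSwap κ i)).prodCongr (Equiv.refl T)

lemma update_eq_update_iff {w w' : I → κ} {i : I} {x x' : κ} :
    Function.update w i x = Function.update w' i x' ↔ (∀ j, j ≠ i → w j = w' j) ∧ x = x' := by
  simp only [funext_iff, Function.update_apply]
  refine ⟨fun h => ⟨fun j hj => by simpa [hj] using h j, by simpa using h i⟩, ?_⟩
  rintro ⟨hne, rfl⟩ j
  by_cases hj : j = i <;> simp [hj, hne]

variable [Fintype I] [Fintype κ] [DecidableEq κ]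

lemma piTensor_mulSingle_apply (i : I) (V : Matrix κ κ ℂ) (w w' : I → κ) :
    piTensor I κ (Pi.mulSingle i V) w w'
      = if ∀ j, j ≠ i → w j = w' j then V (w i) (w' i) else 0 := by
  rw [piTensor_apply, ← Finset.mul_prod_erase _ _ (Finset.mem_univ i), Pi.mulSingle_eq_same,
    Finset.prod_congr rfl fun j hj => by
      rw [Pi.mulSingle_eq_of_ne (Finset.ne_of_mem_erase hj), one_apply],
    Finset.prod_ite_zero]
  simp

variable (I κ) in
/-- The tensor product of the matrices `M i`, acting on the systems of a cell indexed by `I`. -/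
def cellTensor : (I → Matrix κ κ ℂ) →* Matrix (Cell I κ) (Cell I κ) ℂ where
  toFun M := (1 : Matrix (Fin 2) (Fin 2) ℂ) ⊗ₖ (piTensor I κ M ⊗ₖ (1 : Matrix κ κ ℂ))
  map_one' := by rw [map_one, one_kronecker_one, one_kronecker_one]
  map_mul' M M' := by simp only [map_mul, ← mul_kronecker_mul, Matrix.one_mul]

lemma cellTensor_apply (M : I → Matrix κ κ ℂ) :
    cellTensor I κ M = (1 : Matrix (Fin 2) (Fin 2) ℂ) ⊗ₖ (piTensor I κ M ⊗ₖ (1 : Matrix κ κ ℂ)) :=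
  rfl

lemma conjTranspose_cellTensor (M : I → Matrix κ κ ℂ) :
    (cellTensor I κ M)ᴴ = cellTensor I κ fun i => (M i)ᴴ := by
  simp only [cellTensor_apply, conjTranspose_kronecker, conjTranspose_piTensor, conjTranspose_one]

lemma cellTensor_mem_unitaryGroup {M : I → Matrix κ κ ℂ} (hM : ∀ i, M i ∈ unitaryGroup κ ℂ) :
    cellTensor I κ M ∈ unitaryGroup (Cell I κ) ℂ := by
  rw [mem_unitaryGroup_iff, star_eq_conjTranspose, conjTranspose_cellTensor, ← map_mul,
    ← map_one (cellTensor I κ)]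
  exact congrArg (cellTensor I κ) (funext fun i => mem_unitaryGroup_iff.1 (hM i))

variable {a d : ℕ} [Fintype T] [DecidableEq T]

variable (I T a d) in
/-- Encoding of a cell together with a clock `T` into the register of an algorithm, whose
workspace holds the clock and the systems of the cell indexed by `I`. -/
def clockRegister : Cell I (Fin a × Fin d) × T ≃
    Register (Fintype.card (T × (I → Fin a × Fin d))) a d where
  toFun x := (x.1.1, Fintype.equivFin _ (x.2, x.1.2.1), x.1.2.2)
  invFun y := ((y.1, ((Fintype.equivFin _).symm y.2.1).2, y.2.2),
    ((Fintype.equivFin _).symm y.2.1).1)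
  left_inv x := by simp
  right_inv y := by simp

lemma plainCall_submatrix_cellSwap (inverse : Bool) (U : UnitaryOracle a d) (i : I) :
    (plainCall (clockRegister I T a d) inverse U).submatrix (cellSwap _ T i) (cellSwap _ T i)
      = blockDiagonal fun _ =>
          cellTensor I _ (Pi.mulSingle i (if inverse then (U : Matrix _ _ ℂ)ᴴ else U)) := by
  ext ⟨⟨b, w, k⟩, t⟩ ⟨⟨b', w', k'⟩, t'⟩
  simp only [plainCall, OracleCall.toMatrix, submatrix_apply, cellSwap, slotSwap, clockRegister,
    Equiv.prodCongr_apply, Prod.map_apply, Equiv.refl_apply, Equiv.coe_fn_mk, blockDiagonal_apply,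
    cellTensor_apply, kroneckerMap_apply, piTensor_mulSingle_apply, one_apply,
    Equiv.apply_eq_iff_eq, Prod.mk.injEq, update_eq_update_iff, Bool.false_eq_true, if_false]
  split_ifs <;> simp_all

lemma Implements.slot (inverse : Bool) (i : I) :
    Implements (clockRegister I T a d) 1 fun U => blockDiagonal fun _ =>
      cellTensor I _ (Pi.mulSingle i (if inverse then (U : Matrix _ _ ℂ)ᴴ else U)) := by
  have hswap := Implements.gate (e := clockRegister I T a d)
    (permMatrix_mem_unitaryGroup (cellSwap _ T i))
  refine (hswap.mul ((Implements.plainCall inverse).mul hswap)).congr fun U => ?_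
  rw [← plainCall_submatrix_cellSwap, Equiv.Perm.permMatrix, PEquiv.mul_toMatrix_toPEquiv,
    PEquiv.toMatrix_toPEquiv_mul, submatrix_submatrix]
  rfl

lemma Implements.parallel (inverse : Bool) :
    Implements (clockRegister I T a d) (Fintype.card I) fun U => blockDiagonal fun _ =>
      cellTensor I _ fun _ => if inverse then (U : Matrix _ _ ℂ)ᴴ else U := by
  have hpartial (s : Finset I) : Implements (clockRegister I T a d) s.card fun U =>
      blockDiagonal fun _ => cellTensor I _
        (s.piecewise (fun _ => if inverse then (U : Matrix _ _ ℂ)ᴴ else U) 1) := by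
    induction s using Finset.induction_on with
    | empty =>
      simp only [Finset.piecewise_empty, map_one, Finset.card_empty]
      exact (Implements.gate (one_mem _)).congr fun _ => blockDiagonal_one.symm
    | insert i s hi ih =>
      rw [Finset.card_insert_of_notMem hi]
      refine ((Implements.slot inverse i).mul ih).congr fun U => ?_
      rw [← blockDiagonal_mul]
      refine congrArg blockDiagonal (funext fun _ => ?_)
      rw [← map_mul]
      congr 1
      ext1 j
      by_cases hj : j = i
      · simp [hj, hi]
      · simp [hj, Finset.piecewise]
  simpa only [Finset.piecewise_univ, Finset.card_univ] using hpartial Finset.univ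

end parallel

/-! ### The three-term recurrence of two reflections -/

section reflectionWalk

variable {R : Type*} [Fintype R] [DecidableEq R]

/-- The state after `t` steps of the walk that starts in `Ψ` and alternates the operator `F` with
the reflection about `Ψ`. -/
def reflectionWalk (F : Matrix R R ℂ) (Ψ : R → ℂ) (t : ℕ) : R → ℂ := (reflection Ψ * F) ^ t *ᵥ Ψ

lemma reflectionWalk_succ (F : Matrix R R ℂ) (Ψ : R → ℂ) (t : ℕ) :
    reflectionWalk F Ψ (t + 1) = (reflection Ψ * F) *ᵥ reflectionWalk F Ψ t := by
  rw [reflectionWalk, reflectionWalk, mulVec_mulVec, pow_succ']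

lemma isUnitVector_reflectionWalk {F : Matrix R R ℂ} (hF : F ∈ unitaryGroup R ℂ) {Ψ : R → ℂ}
    (hΨ : IsUnitVector Ψ) (t : ℕ) : IsUnitVector (reflectionWalk F Ψ t) :=
  hΨ.unitary_mulVec (pow_mem (mul_mem (reflection_mem_unitaryGroup hΨ) hF) t)

lemma reflectionWalk_add_two_add {F : Matrix R R ℂ} (hF : F * F = 1) {Ψ : R → ℂ}
    (hΨ : IsUnitVector Ψ) {μ : ℂ} (hμ : star Ψ ⬝ᵥ (F *ᵥ Ψ) = μ) (t : ℕ) :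
    reflectionWalk F Ψ (t + 2) + reflectionWalk F Ψ t
      = (2 * μ) • reflectionWalk F Ψ (t + 1) := by
  have hfixed : reflection Ψ *ᵥ Ψ = Ψ := by
    rw [reflection_mulVec, hΨ]
    module
  have hstep : (reflection Ψ * F) *ᵥ Ψ = (2 * μ) • Ψ - F *ᵥ Ψ := by
    rw [← mulVec_mulVec, reflection_mulVec, hμ]
  have hback : (reflection Ψ * F) *ᵥ (F *ᵥ Ψ) = Ψ := by
    rw [mulVec_mulVec, mul_assoc, hF, mul_one, hfixed]
  have hzero : reflectionWalk F Ψ 2 + Ψ = (2 * μ) • reflectionWalk F Ψ 1 := by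
    rw [reflectionWalk, reflectionWalk, pow_one, sq, ← mulVec_mulVec, hstep, mulVec_sub,
      mulVec_smul, hback, hstep]
    abel
  calc reflectionWalk F Ψ (t + 2) + reflectionWalk F Ψ t
      = (reflection Ψ * F) ^ t *ᵥ (reflectionWalk F Ψ 2 + Ψ) := by
        rw [mulVec_add, reflectionWalk, reflectionWalk, reflectionWalk, mulVec_mulVec, pow_add]
    _ = (2 * μ) • reflectionWalk F Ψ (t + 1) := by
        rw [hzero, mulVec_smul, reflectionWalk, reflectionWalk, mulVec_mulVec, pow_add]

end reflectionWalk

/-! ### Superpositions over a clock -/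

section clock

/-- The amplitudes of the clock values `1, …, N`, normalised by
`∑ t² (N + 1 - t)² = ((N + 1)⁵ - (N + 1)) / 30`. They vanish at `0` and at `N + 1`. -/
def clockWeight (N t : ℕ) : ℝ := t * (N + 1 - t) / √(((N + 1) ^ 5 - (N + 1)) / 30)

lemma clockWeight_zero (N : ℕ) : clockWeight N 0 = 0 := by simp [clockWeight]

lemma clockWeight_add_one_self (N : ℕ) : clockWeight N (N + 1) = 0 := by simp [clockWeight]

lemma sum_range_succ_mul_sub_sq (n : ℕ) (y : ℝ) :
    ∑ t ∈ Finset.range n, (((t + 1 : ℕ) : ℝ) * (y - (t + 1 : ℕ))) ^ 2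
      = y ^ 2 * (n * (n + 1) * (2 * n + 1) / 6) - 2 * y * (n ^ 2 * (n + 1) ^ 2 / 4)
        + n * (n + 1) * (2 * n + 1) * (3 * n ^ 2 + 3 * n - 1) / 30 := by
  induction n with
  | zero => simp
  | succ n ih =>
    rw [Finset.sum_range_succ, ih]
    push_cast
    ring

lemma pow_five_le_add_one_pow_five_sub (N : ℕ) :
    (N : ℝ) ^ 5 ≤ (N + 1) ^ 5 - (N + 1) := by
  have hexpand : ((N : ℝ) + 1) ^ 5 - (N + 1)
      = N ^ 5 + (5 * N ^ 4 + 10 * N ^ 3 + 10 * N ^ 2 + 4 * N) := by ring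
  rw [hexpand]
  exact le_add_of_nonneg_right (by positivity)

variable {N : ℕ}

lemma sum_clockWeight_sq (hN : N ≠ 0) : ∑ t : Fin N, clockWeight N (t + 1) ^ 2 = 1 := by
  have hpos : (0 : ℝ) < ((N + 1) ^ 5 - (N + 1)) / 30 :=
    div_pos ((by positivity : (0 : ℝ) < N ^ 5).trans_le (pow_five_le_add_one_pow_five_sub N))
      (by norm_num)
  have hsum : ∑ t ∈ Finset.range N, (((t + 1 : ℕ) : ℝ) * (N + 1 - (t + 1 : ℕ))) ^ 2
      = (((N : ℝ) + 1) ^ 5 - (N + 1)) / 30 := by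
    rw [sum_range_succ_mul_sub_sq]
    ring
  simp only [clockWeight, div_pow, Real.sq_sqrt hpos.le]
  rw [← Finset.sum_div,
    Fin.sum_univ_eq_sum_range fun t => (((t + 1 : ℕ) : ℝ) * (N + 1 - (t + 1 : ℕ))) ^ 2, hsum,
    div_self hpos.ne']

lemma sq_clockWeight_succ_sub_le (hN : N ≠ 0) {t : ℕ} (ht : t ≤ N) :
    (clockWeight N (t + 1) - clockWeight N t) ^ 2 ≤ 30 / N ^ 3 := by
  have hdiff : clockWeight N (t + 1) - clockWeight N t
      = (N - 2 * t) / √(((N + 1) ^ 5 - (N + 1)) / 30) := by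
    simp only [clockWeight]
    push_cast
    ring
  have hnum : ((N : ℝ) - 2 * t) ^ 2 ≤ N ^ 2 := by
    have ht' : (t : ℝ) ≤ N := by exact_mod_cast ht
    exact sq_le_sq' (by linarith) (sub_le_self _ (by positivity))
  have hden : (N : ℝ) ^ 5 / 30 ≤ ((N + 1) ^ 5 - (N + 1)) / 30 := by
    gcongr
    exact pow_five_le_add_one_pow_five_sub N
  rw [hdiff, div_pow, Real.sq_sqrt (le_trans (by positivity) hden)]
  calc ((N : ℝ) - 2 * t) ^ 2 / ((((N : ℝ) + 1) ^ 5 - (N + 1)) / 30)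
      ≤ (N : ℝ) ^ 2 / ((N : ℝ) ^ 5 / 30) := by gcongr
    _ = 30 / (N : ℝ) ^ 3 := by field_simp

/-- Half the adjacency matrix of a path with `N` vertices, acting on the clock. -/
def clockObservable (R : Type*) [DecidableEq R] (N : ℕ) : Matrix (R × Fin N) (R × Fin N) ℂ :=
  Matrix.of fun x y => if x.1 = y.1 then
    (1 / 2) * ((if (y.2 : ℕ) = x.2 + 1 then 1 else 0) + if (x.2 : ℕ) = y.2 + 1 then 1 else 0)
  else 0

lemma isHermitian_clockObservable (R : Type*) [DecidableEq R] (N : ℕ) :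
    (clockObservable R N).IsHermitian := by
  ext x y
  simp only [conjTranspose_apply, clockObservable, of_apply, eq_comm (a := y.1)]
  split_ifs <;> simp

variable {R : Type*}

/-- The superposition of the states `u 1 ⊗ |1⟩, …, u N ⊗ |N⟩` of a system and a clock with the
amplitudes `clockWeight`. The clock value `t + 1` is encoded by `t : Fin N`. -/
def clockState (N : ℕ) (u : ℕ → R → ℂ) : R × Fin N → ℂ :=
  fun x => (clockWeight N (x.2 + 1) : ℂ) * u (x.2 + 1) x.1

lemma clockState_slice (u : ℕ → R → ℂ) (t : Fin N) :
    (fun r => clockState N u (r, t)) = (clockWeight N (t + 1) : ℂ) • u (t + 1) := rfl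

lemma sum_ite_mul_clockState (u : ℕ → R → ℂ) (r : R) {n : ℕ} (hn : n ≤ N + 1) :
    ∑ s : Fin N, (if (s : ℕ) + 1 = n then 1 else 0) * clockState N u (r, s)
      = clockWeight N n * u n r := by
  by_cases hmem : 1 ≤ n ∧ n ≤ N
  · obtain ⟨s, rfl⟩ : ∃ s : Fin N, (s : ℕ) + 1 = n := ⟨⟨n - 1, by omega⟩, by simp; omega⟩
    simp [Fin.val_inj, clockState]
  · have hweight : clockWeight N n = 0 := by
      obtain rfl | rfl : n = 0 ∨ n = N + 1 := by omega
      exacts [clockWeight_zero N, clockWeight_add_one_self N]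
    rw [hweight, Complex.ofReal_zero, zero_mul]
    exact Finset.sum_eq_zero fun s _ => by rw [if_neg (by omega), zero_mul]

variable [Fintype R]

lemma sqNorm_prod {T : Type*} [Fintype T] (v : R × T → ℂ) :
    sqNorm v = ∑ t, sqNorm fun r => v (r, t) :=
  Fintype.sum_prod_type_right _

lemma isUnitVector_clockState (hN : N ≠ 0) {u : ℕ → R → ℂ} (hu : ∀ t, IsUnitVector (u t)) :
    IsUnitVector (clockState N u) := by
  rw [isUnitVector_iff, sqNorm_prod, ← sum_clockWeight_sq hN]
  refine Finset.sum_congr rfl fun t _ => ?_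
  rw [clockState_slice, sqNorm_smul, (hu _).sqNorm_eq_one, Complex.norm_real, Real.norm_eq_abs,
    sq_abs, mul_one]

lemma blockDiagonal_mulVec_clockState {Q : Fin N → Matrix R R ℂ} {u v : ℕ → R → ℂ}
    (hQ : ∀ t : Fin N, Q t *ᵥ u (t + 1) = v (t + 1)) :
    blockDiagonal Q *ᵥ clockState N u = clockState N v := by
  ext ⟨r, t⟩
  rw [blockDiagonal_mulVec_apply, clockState_slice, mulVec_smul, hQ]
  rfl

variable [DecidableEq R]

lemma clockObservable_mulVec_clockState_apply (u : ℕ → R → ℂ) (r : R) (t : Fin N) :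
    (clockObservable R N *ᵥ clockState N u) (r, t)
      = (1 / 2) * (clockWeight N (t + 2) * u (t + 2) r + clockWeight N t * u t r) := by
  rw [← sum_ite_mul_clockState u r (by omega : (t : ℕ) + 2 ≤ N + 1),
    ← sum_ite_mul_clockState u r (by omega : (t : ℕ) ≤ N + 1), ← Finset.sum_add_distrib,
    Finset.mul_sum]
  simp only [mulVec, dotProduct, Fintype.sum_prod_type_right, clockObservable, of_apply, ite_mul,
    zero_mul, Finset.sum_ite_eq, Finset.mem_univ, if_true]
  refine Finset.sum_congr rfl fun s _ => ?_
  have hnext : (s : ℕ) = t + 1 ↔ (s : ℕ) + 1 = t + 2 := by omega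
  simp only [hnext, eq_comm (a := (t : ℕ)), mul_assoc, add_mul, ite_mul, one_mul, zero_mul]

lemma sqNorm_clockObservable_mulVec_clockState_sub_le (hN : N ≠ 0) {u : ℕ → R → ℂ}
    (hu : ∀ t, IsUnitVector (u t)) {μ : ℂ}
    (hrec : ∀ t, u (t + 2) + u t = (2 * μ) • u (t + 1)) :
    sqNorm (clockObservable R N *ᵥ clockState N u - μ • clockState N u) ≤ 30 / N ^ 2 := by
  have hslice (t : Fin N) : sqNorm (fun r => (clockObservable R N *ᵥ clockState N u
      - μ • clockState N u) (r, t)) ≤ 30 / N ^ 3 := by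
    -- By the recurrence, `2 μ u (t + 1)` cancels up to the differences of consecutive weights.
    have hcancel : (fun r => (clockObservable R N *ᵥ clockState N u - μ • clockState N u) (r, t))
        = (((clockWeight N (t + 2) - clockWeight N (t + 1)) / 2 : ℝ) : ℂ) • u (t + 2)
          + (((clockWeight N t - clockWeight N (t + 1)) / 2 : ℝ) : ℂ) • u t := by
      ext r
      have hrecr := congrFun (hrec t) r
      simp only [Pi.add_apply, Pi.smul_apply, smul_eq_mul] at hrecr
      simp only [Pi.sub_apply, clockObservable_mulVec_clockState_apply, Pi.add_apply,
        Pi.smul_apply, smul_eq_mul, clockState]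
      push_cast
      linear_combination (clockWeight N (t + 1) / 2 : ℂ) * hrecr
    have hnext := sq_clockWeight_succ_sub_le hN (t := t + 1) (by omega)
    have hprev := sq_clockWeight_succ_sub_le hN (t := t) (by omega)
    rw [hcancel]
    refine (sqNorm_add_le _ _).trans ?_
    rw [sqNorm_smul, sqNorm_smul, (hu _).sqNorm_eq_one, (hu _).sqNorm_eq_one, Complex.norm_real,
      Complex.norm_real, Real.norm_eq_abs, Real.norm_eq_abs, sq_abs, sq_abs]
    linarith
  rw [sqNorm_prod]
  calc _ ≤ ∑ _ : Fin N, 30 / (N : ℝ) ^ 3 := Finset.sum_le_sum fun t _ => hslice t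
    _ = 30 / N ^ 2 := by
      rw [Finset.sum_const, Finset.card_univ, Fintype.card_fin, nsmul_eq_mul]
      field_simp

end clock

/-! ### The moment as a matrix element of an involution -/

section controlledTensor

variable {X Y : Type*}

/-- The vector `(|0⟩ ⊗ f 0 + |1⟩ ⊗ f 1) ⊗ g / √2`, in which a qubit controls the state of a second
system. -/
def controlledTensor (f : Fin 2 → X → ℂ) (g : Y → ℂ) : Fin 2 × X × Y → ℂ :=
  fun x => ((√2)⁻¹ : ℝ) * (f x.1 x.2.1 * g x.2.2)

/-- The involution that flips a qubit and applies `π` or its inverse to a second system, depending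
on the value of the qubit. -/
def flipPerm (Y : Type*) (π : Equiv.Perm X) : Equiv.Perm (Fin 2 × X × Y) :=
  Function.Involutive.toPerm
    (fun x => (x.1 + 1, if x.1 = 0 then π x.2.1 else π.symm x.2.1, x.2.2)) fun ⟨b, x, y⟩ => by
      fin_cases b <;> simp

lemma flipPerm_mul_self (π : Equiv.Perm X) : flipPerm Y π * flipPerm Y π = 1 :=
  inv_eq_iff_mul_eq_one.1 rfl

lemma controlledTensor_comp_flipPerm (π : Equiv.Perm X) (f : Fin 2 → X → ℂ) (g : Y → ℂ) :
    controlledTensor f g ∘ flipPerm Y π = controlledTensor ![f 1 ∘ π, f 0 ∘ π.symm] g := by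
  ext ⟨b, x, y⟩
  fin_cases b <;> rfl

variable [Fintype X] [Fintype Y]

lemma star_controlledTensor_dotProduct_controlledTensor (f f' : Fin 2 → X → ℂ) (g g' : Y → ℂ) :
    star (controlledTensor f g) ⬝ᵥ controlledTensor f' g'
      = (1 / 2) * (star (f 0) ⬝ᵥ f' 0 + star (f 1) ⬝ᵥ f' 1) * (star g ⬝ᵥ g') := by
  have hsqrt : (((√2)⁻¹ : ℝ) : ℂ) * ((√2)⁻¹ : ℝ) = 1 / 2 := by
    rw [← Complex.ofReal_mul, ← mul_inv, Real.mul_self_sqrt (by norm_num)]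
    norm_num
  have hterm (b : Fin 2) : ∑ x, ∑ y, star (controlledTensor f g (b, x, y)) *
      controlledTensor f' g' (b, x, y) = (1 / 2) * (star (f b) ⬝ᵥ f' b) * (star g ⬝ᵥ g') := by
    simp only [dotProduct, controlledTensor, Pi.star_apply, star_mul', Complex.star_def,
      Complex.conj_ofReal, mul_assoc, Finset.sum_mul_sum]
    simp only [Finset.mul_sum]
    refine Finset.sum_congr rfl fun x _ => Finset.sum_congr rfl fun y _ => ?_
    rw [← hsqrt]
    ring
  rw [dotProduct, Fintype.sum_prod_type, Fin.sum_univ_two]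
  simp only [Fintype.sum_prod_type, Pi.star_apply, hterm]
  ring

lemma IsUnitVector.controlledTensor {f : Fin 2 → X → ℂ} {g : Y → ℂ}
    (hf : ∀ b, IsUnitVector (f b)) (hg : IsUnitVector g) :
    IsUnitVector (controlledTensor f g) := by
  rw [IsUnitVector, star_controlledTensor_dotProduct_controlledTensor, hf 0, hf 1, hg]
  norm_num

lemma cellTensor_mulVec_controlledTensor {I κ : Type*} [Fintype I] [DecidableEq I] [Fintype κ]
    [DecidableEq κ] (M : I → Matrix κ κ ℂ) (f : Fin 2 → (I → κ) → ℂ) (g : κ → ℂ) :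
    cellTensor I κ M *ᵥ controlledTensor f g
      = controlledTensor (fun b => piTensor I κ M *ᵥ f b) g := by
  ext ⟨b, w, k⟩
  simp only [mulVec, dotProduct, Fintype.sum_prod_type, cellTensor_apply, kroneckerMap_apply,
    one_apply, controlledTensor, ite_mul, one_mul, zero_mul, mul_ite, mul_one, mul_zero,
    Finset.sum_ite_irrel, Finset.sum_const_zero, Finset.sum_ite_eq, Finset.mem_univ, if_true,
    Finset.mul_sum, Finset.sum_mul]
  exact Finset.sum_congr rfl fun x _ => by ring

end controlledTensor

section cyclicFlip

variable (m : ℕ) (α β : Type*) [DecidableEq α] [DecidableEq β]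

/-- The operator on a cell that flips the control qubit and cyclically permutes the second
components of the `m` systems, in a direction given by the qubit. -/
def cyclicFlip : Matrix (Cell (Fin m) (α × β)) (Cell (Fin m) (α × β)) ℂ :=
  Equiv.Perm.permMatrix ℂ (flipPerm (α × β) (permuteB (finRotate m)))

variable [Fintype α] [Fintype β]

lemma cyclicFlip_mem_unitaryGroup : cyclicFlip m α β ∈ unitaryGroup (Cell (Fin m) (α × β)) ℂ :=
  permMatrix_mem_unitaryGroup _

lemma cyclicFlip_mul_self : cyclicFlip m α β * cyclicFlip m α β = 1 := by
  rw [cyclicFlip, ← permMatrix_mul, flipPerm_mul_self, permMatrix_one]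

variable {m α β}

lemma star_dotProduct_cyclicFlip_mulVec (ψ : α × β → ℂ) (hm : m ≠ 0) {g : α × β → ℂ}
    (hg : IsUnitVector g) :
    star (controlledTensor (fun _ => piVec fun _ : Fin m => ψ) g) ⬝ᵥ
        (cyclicFlip m α β *ᵥ controlledTensor (fun _ => piVec fun _ => ψ) g)
      = powerTrace (reducedState ψ) m := by
  rw [cyclicFlip, permMatrix_mulVec, controlledTensor_comp_flipPerm,
    star_controlledTensor_dotProduct_controlledTensor, hg]
  simp only [cons_val_zero, cons_val_one, star_piVec_dotProduct_comp_permuteB_finRotate ψ hm,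
    star_piVec_dotProduct_comp_permuteB_finRotate_symm ψ hm]
  ring

end cyclicFlip

/-! ### The upper bound for the unitary oracle -/

section preparedCell

variable {m N a d : ℕ} [NeZero a] [NeZero d]

/-- A cell with its control qubit in the state `|+⟩` and all its systems in the state `|0⟩`. -/
def zeroCell (m a d : ℕ) [NeZero a] [NeZero d] : Cell (Fin m) (Fin a × Fin d) → ℂ :=
  controlledTensor (fun _ => piVec fun _ => Pi.single (0, 0) 1) (Pi.single (0, 0) 1)

/-- The cell obtained from `zeroCell` by one call of the oracle `U` on each of the `m` systems. -/
def preparedCell (m : ℕ) (U : UnitaryOracle a d) : Cell (Fin m) (Fin a × Fin d) → ℂ :=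
  controlledTensor (fun _ => piVec fun _ => preparedState U) (Pi.single (0, 0) 1)

lemma cellTensor_mulVec_zeroCell (U : UnitaryOracle a d) :
    (cellTensor (Fin m) _ fun _ => (U : Matrix _ _ ℂ)) *ᵥ zeroCell m a d = preparedCell m U := by
  simp only [zeroCell, cellTensor_mulVec_controlledTensor, piTensor_mulVec_piVec]
  rfl

lemma isUnitVector_zeroCell : IsUnitVector (zeroCell m a d) :=
  .controlledTensor (fun _ => .piVec fun _ => isUnitVector_single _) (isUnitVector_single _)

lemma isUnitVector_preparedState (U : UnitaryOracle a d) :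
    IsUnitVector (preparedState (U : Matrix (Fin a × Fin d) (Fin a × Fin d) ℂ)) :=
  (isUnitVector_single _).unitary_mulVec U.2

lemma isUnitVector_preparedCell (U : UnitaryOracle a d) : IsUnitVector (preparedCell m U) :=
  .controlledTensor (fun _ => .piVec fun _ => isUnitVector_preparedState U)
    (isUnitVector_single _)

/-- The walk driven by the oracle `U`. -/
def oracleWalk (m : ℕ) (U : UnitaryOracle a d) (t : ℕ) : Cell (Fin m) (Fin a × Fin d) → ℂ :=
  reflectionWalk (cyclicFlip m (Fin a) (Fin d)) (preparedCell m U) t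

lemma reflection_preparedCell (U : UnitaryOracle a d) :
    reflection (preparedCell m U) = (cellTensor (Fin m) _ fun _ => (U : Matrix _ _ ℂ)) *
      reflection (zeroCell m a d) * cellTensor (Fin m) _ fun _ => (U : Matrix _ _ ℂ)ᴴ := by
  rw [← cellTensor_mulVec_zeroCell,
    ← mul_reflection_mul (cellTensor_mem_unitaryGroup fun _ => U.2), conjTranspose_cellTensor]

/-- No controlled calls are needed: where the gates between them are switched off, the calls to `U`
and to its inverse cancel. -/
lemma implements_clockStep (s : ℕ) :
    Implements (clockRegister (Fin m) (Fin N) a d) (2 * m) fun U =>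
      blockDiagonal fun t : Fin N => if s ≤ (t : ℕ) then
        reflection (preparedCell m U) * cyclicFlip m (Fin a) (Fin d) else 1 := by
  have hgate {A : Matrix (Cell (Fin m) (Fin a × Fin d)) (Cell (Fin m) (Fin a × Fin d)) ℂ}
      (hA : A ∈ unitaryGroup _ ℂ) : Implements (clockRegister (Fin m) (Fin N) a d) 0 fun _ =>
        blockDiagonal fun t : Fin N => if s ≤ (t : ℕ) then A else 1 :=
    .gate (blockDiagonal_mem_unitaryGroup fun t => by
      split_ifs
      exacts [hA, one_mem _])
  have hcircuit := (Implements.parallel (I := Fin m) (T := Fin N) (a := a) (d := d) false).mul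
    ((hgate (reflection_mem_unitaryGroup isUnitVector_zeroCell)).mul
      ((Implements.parallel true).mul (hgate (cyclicFlip_mem_unitaryGroup m (Fin a) (Fin d)))))
  rw [Fintype.card_fin, zero_add, add_zero, ← two_mul] at hcircuit
  refine hcircuit.congr fun U => ?_
  rw [← blockDiagonal_mul, ← blockDiagonal_mul, ← blockDiagonal_mul]
  refine congrArg blockDiagonal (funext fun t => ?_)
  simp only [Bool.false_eq_true, if_false, if_true]
  split_ifs
  · rw [reflection_preparedCell, mul_assoc, mul_assoc]
  · rw [one_mul, mul_one, ← map_mul, ← map_one (cellTensor (Fin m) (Fin a × Fin d))]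
    exact congrArg _ (funext fun _ => mem_unitaryGroup_iff.1 U.2)

lemma prepares_clockState_oracleWalk (m a d : ℕ) [NeZero a] [NeZero d] (hN : N ≠ 0) :
    Prepares (clockRegister (Fin m) (Fin N) a d) (m + 2 * m * N) fun U =>
      clockState N (oracleWalk m U) := by
  have hpartial (s : ℕ) : Prepares (clockRegister (Fin m) (Fin N) a d) (m + 2 * m * s) fun U =>
      clockState N fun t => oracleWalk m U (min s t) := by
    induction s with
    | zero =>
      have hstart := Implements.parallel (I := Fin m) (T := Fin N) (a := a) (d := d) false
        (.init (isUnitVector_clockState hN fun _ => isUnitVector_zeroCell (m := m)))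
      rw [Fintype.card_fin, zero_add] at hstart
      rw [mul_zero, add_zero]
      convert hstart using 2 with U
      refine (blockDiagonal_mulVec_clockState fun t => ?_).symm
      rw [Nat.zero_min, oracleWalk, reflectionWalk, pow_zero, one_mulVec]
      exact cellTensor_mulVec_zeroCell U
    | succ s ih =>
      have hnext := implements_clockStep s ih
      rw [add_assoc, ← mul_add_one] at hnext
      convert hnext using 2 with U
      refine (blockDiagonal_mulVec_clockState fun t => ?_).symm
      split_ifs with hst
      · rw [min_eq_left (by omega), min_eq_left (by omega)]
        exact (reflectionWalk_succ _ _ s).symm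
      · rw [one_mulVec, min_eq_right (by omega), min_eq_right (by omega)]
  convert hpartial N using 2 with U
  ext ⟨r, t⟩
  rw [clockState, clockState, min_eq_right (by omega)]

end preparedCell

lemma UnitaryAlgorithm.exists_const (a d : ℕ) [NeZero a] [NeZero d] (c : ℝ) :
    ∃ alg : UnitaryAlgorithm a d, alg.queries = 0 ∧ alg.UsesPlainCalls ∧
      ∀ U S, c ∈ S → alg.outputProb U S = 1 := by
  have hunit : IsUnitVector (Pi.single ((0, 0, 0, 0) : Register 1 a d) (1 : ℂ)) :=
    isUnitVector_single _
  refine ⟨⟨1, ketBra _, isDensity_ketBra hunit, [],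
    ⟨1, fun _ => 1, fun _ => PosSemidef.one, by simp, fun _ => c⟩⟩, rfl, by simp [UsesPlainCalls],
    fun U S hS => ?_⟩
  simp [outputProb, finalState, Measurement.prob, hS, trace_ketBra, hunit.sqNorm_eq_one]

lemma UnitaryAlgorithm.exists_estimator (a d : ℕ) [NeZero a] [NeZero d] {N m : ℕ} (hN : N ≠ 0)
    (hm : m ≠ 0) :
    ∃ alg : UnitaryAlgorithm a d, alg.queries = m + 2 * m * N ∧ alg.UsesPlainCalls ∧
      ∀ U ∈ unitaryGroup (Fin a × Fin d) ℂ, ∀ ε : ℝ, 0 < ε →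
        1 - 30 / (N ^ 2 * ε ^ 2)
          ≤ alg.outputProb U (within (reducedState (preparedState U)) m ε) := by
  obtain ⟨alg, hqueries, hplain, hprob⟩ :=
    (prepares_clockState_oracleWalk m a d hN).exists_measure (isHermitian_clockObservable _ N)
  refine ⟨alg, hqueries, hplain, fun U hU ε hε => ?_⟩
  have hunit := isUnitVector_preparedCell (m := m) ⟨U, hU⟩
  have hspread := sqNorm_clockObservable_mulVec_clockState_sub_le hN
    (isUnitVector_reflectionWalk (cyclicFlip_mem_unitaryGroup m (Fin a) (Fin d)) hunit)
    (reflectionWalk_add_two_add (cyclicFlip_mul_self m (Fin a) (Fin d)) hunit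
      (star_dotProduct_cyclicFlip_mulVec (preparedState U) hm (isUnitVector_single _)))
  rw [within_reducedState, ← div_div]
  refine le_trans ?_ (hprob ⟨U, hU⟩ (powerTrace (reducedState (preparedState U)) m) ε hε)
  gcongr
  exact hspread

theorem UnitaryAlgorithm.exists_queries_le (a d m : ℕ) [NeZero a] [NeZero d] {ε : ℝ}
    (hε : 0 < ε) :
    ∃ alg : UnitaryAlgorithm a d, (alg.queries : ℝ) ≤ 23 * (m / ε) ∧ alg.UsesPlainCalls ∧
      ∀ U ∈ unitaryGroup (Fin a × Fin d) ℂ,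
        2 / 3 < alg.outputProb U (within (reducedState (preparedState U)) m ε) := by
  by_cases htriv : m = 0 ∨ 1 ≤ ε
  · obtain ⟨c, hc⟩ := exists_forall_mem_within (α := Fin a) (β := Fin d) hε htriv
    obtain ⟨alg, hqueries, hplain, hprob⟩ := exists_const a d c
    refine ⟨alg, by rw [hqueries, Nat.cast_zero]; positivity, hplain, fun U hU => ?_⟩
    rw [hprob U _ (hc _ (isUnitVector_preparedState ⟨U, hU⟩))]
    norm_num
  obtain ⟨hm, hε1⟩ := not_or.1 htriv
  have hlower : 10 / ε ≤ ⌈10 / ε⌉₊ := Nat.le_ceil _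
  have hupper : (⌈10 / ε⌉₊ : ℝ) < 10 / ε + 1 := Nat.ceil_lt_add_one (by positivity)
  have hone : 1 ≤ 1 / ε := (one_le_div hε).2 (not_le.1 hε1).le
  obtain ⟨alg, hqueries, hplain, hprob⟩ :=
    exists_estimator a d (Nat.ceil_pos.2 (show 0 < 10 / ε by positivity)).ne' hm
  refine ⟨alg, ?_, hplain, fun U hU => lt_of_lt_of_le ?_ (hprob U hU ε hε)⟩
  · calc (alg.queries : ℝ) = m * (1 + 2 * ⌈10 / ε⌉₊) := by
          rw [hqueries]
          push_cast
          ring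
      _ ≤ m * (1 / ε + 2 * (10 / ε + 1 / ε)) := by gcongr; linarith
      _ = 23 * (m / ε) := by ring
  · have hfail : 30 / (⌈10 / ε⌉₊ ^ 2 * ε ^ 2) ≤ (30 / 10 ^ 2 : ℝ) := by
      rw [← mul_pow]
      gcongr
      exact (div_le_iff₀ hε).1 hlower
    norm_num at hfail ⊢
    linarith

end QuantumQuery

end

theorem mainTheorem9_general :
    ((∃ C : ℝ, 0 < C ∧ ∀ (d a m : ℕ) (ε : ℝ), 0 < ε →
        ∃ alg : QuantumQuery.CopyAlgorithm a d,
          (alg.queries : ℝ) ≤ C * (m / ε ^ 2) ∧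
          ∀ ψ : Fin a × Fin d → ℂ, QuantumQuery.IsUnitVector ψ →
            2 / 3 < alg.outputProb ψ
              (QuantumQuery.within (QuantumQuery.reducedState ψ) m ε)) ∧
      (∃ c : ℝ, 0 < c ∧ ∃ m₀ : ℕ, ∀ (d a m : ℕ), 2 ≤ d → 2 ≤ a → m₀ ≤ m →
        ∀ alg : QuantumQuery.CopyAlgorithm a d,
          (∀ ψ : Fin a × Fin d → ℂ, QuantumQuery.IsUnitVector ψ →
            2 / 3 ≤ alg.outputProb ψ
              (QuantumQuery.strictlyWithin (QuantumQuery.reducedState ψ) m (1 / 3))) →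
          c * m ≤ alg.queries)) ∧
    ((∃ C : ℝ, 0 < C ∧ ∀ (d a m : ℕ) [NeZero a] [NeZero d] (ε : ℝ), 0 < ε →
        ∃ alg : QuantumQuery.UnitaryAlgorithm a d,
          (alg.queries : ℝ) ≤ C * (m / ε) ∧ alg.UsesPlainCalls ∧
          ∀ U ∈ Matrix.unitaryGroup (Fin a × Fin d) ℂ,
            2 / 3 < alg.outputProb U
              (QuantumQuery.within
                (QuantumQuery.reducedState (QuantumQuery.preparedState U)) m ε)) ∧
      (∃ c : ℝ, 0 < c ∧ ∃ m₀ : ℕ, ∀ (d a m : ℕ) [NeZero a] [NeZero d], 2 ≤ d → 2 ≤ a →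
        m₀ ≤ m → ∀ alg : QuantumQuery.UnitaryAlgorithm a d,
          (∀ U ∈ Matrix.unitaryGroup (Fin a × Fin d) ℂ,
            2 / 3 ≤ alg.outputProb U
              (QuantumQuery.strictlyWithin
                (QuantumQuery.reducedState (QuantumQuery.preparedState U)) m (1 / 3))) →
          c * √(m : ℝ) ≤ alg.queries)) :=
  ⟨⟨⟨5, by norm_num, fun d a m _ hε => QuantumQuery.CopyAlgorithm.exists_queries_le a d m hε⟩,
    ⟨1 / 144, by norm_num, 20, fun _ _ _ hd ha hm alg h =>
      QuantumQuery.CopyAlgorithm.le_queries ha hd hm alg h⟩⟩,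
    ⟨⟨23, by norm_num, fun d a m _ _ _ hε =>
      QuantumQuery.UnitaryAlgorithm.exists_queries_le a d m hε⟩,
    ⟨1 / 18, by norm_num, 20, fun _ _ _ _ _ hd ha hm alg h =>
      QuantumQuery.UnitaryAlgorithm.le_queries ha hd hm alg h⟩⟩⟩

theorem mainTheorem9 :
    -- copy-producing oracle: `O(m / ε²)` queries suffice
    ((∃ C : ℝ, 0 < C ∧ ∀ (n a m : ℕ) (ε : ℝ), 0 < ε →
        ∃ alg : QuantumQuery.CopyAlgorithm a (2 ^ n),
          (alg.queries : ℝ) ≤ C * (m / ε ^ 2) ∧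
          ∀ ψ : Fin a × Fin (2 ^ n) → ℂ, QuantumQuery.IsUnitVector ψ →
            2 / 3 < alg.outputProb ψ
              (QuantumQuery.within (QuantumQuery.reducedState ψ) m ε)) ∧
    -- copy-producing oracle: `Ω(m)` queries are necessary
      (∃ c : ℝ, 0 < c ∧ ∃ m₀ : ℕ, ∀ (n a m : ℕ), 1 ≤ n → 2 ≤ a → m₀ ≤ m →
        ∀ alg : QuantumQuery.CopyAlgorithm a (2 ^ n),
          (∀ ψ : Fin a × Fin (2 ^ n) → ℂ, QuantumQuery.IsUnitVector ψ →
            2 / 3 ≤ alg.outputProb ψ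
              (QuantumQuery.strictlyWithin (QuantumQuery.reducedState ψ) m (1 / 3))) →
          c * m ≤ alg.queries)) ∧
    -- unitary oracle with known inverse: `O(m / ε)` queries suffice
    ((∃ C : ℝ, 0 < C ∧ ∀ (n a m : ℕ) [NeZero a] (ε : ℝ), 0 < ε →
        ∃ alg : QuantumQuery.UnitaryAlgorithm a (2 ^ n),
          (alg.queries : ℝ) ≤ C * (m / ε) ∧ alg.UsesPlainCalls ∧
          ∀ U ∈ Matrix.unitaryGroup (Fin a × Fin (2 ^ n)) ℂ,
            2 / 3 < alg.outputProb U
              (QuantumQuery.within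
                (QuantumQuery.reducedState (QuantumQuery.preparedState U)) m ε)) ∧
    -- unitary oracle with known inverse: `Ω(√m)` queries are necessary
      (∃ c : ℝ, 0 < c ∧ ∃ m₀ : ℕ, ∀ (n a m : ℕ) [NeZero a], 1 ≤ n → 2 ≤ a → m₀ ≤ m →
        ∀ alg : QuantumQuery.UnitaryAlgorithm a (2 ^ n),
          (∀ U ∈ Matrix.unitaryGroup (Fin a × Fin (2 ^ n)) ℂ,
            2 / 3 ≤ alg.outputProb U
              (QuantumQuery.strictlyWithin
                (QuantumQuery.reducedState (QuantumQuery.preparedState U)) m (1 / 3))) →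
          c * √(m : ℝ) ≤ alg.queries)) := by
  obtain ⟨⟨⟨C, hC, hcopyUpper⟩, c, hc, m₀, hcopyLower⟩, ⟨C', hC', hunitaryUpper⟩, c', hc', m₁,
    hunitaryLower⟩ := mainTheorem9_general
  have htwo (n : ℕ) (hn : 1 ≤ n) : 2 ≤ 2 ^ n := Nat.le_self_pow (by omega) 2
  exact ⟨⟨⟨C, hC, fun n => hcopyUpper (2 ^ n)⟩,
      c, hc, m₀, fun n a m hn => hcopyLower (2 ^ n) a m (htwo n hn)⟩,
    ⟨C', hC', fun n a m _ => hunitaryUpper (2 ^ n) a m⟩,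
      c', hc', m₁, fun n a m _ hn => hunitaryLower (2 ^ n) a m (htwo n hn)⟩
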